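/- For finite sequences $\mathbf e=(e_1,\dots,e_{q_1})$ and $\mathbf f=(f_1,\dots,f_{q_2})$ of positive integers put $|\mathbf e|=\sum_i e_i$, $|\mathbf f|=\sum_j f_j$, $M_{\mathbf e,\mathbf f}=\max(e_1,\dots,e_{q_1},f_1,\dots,f_{q_2})$, $$\Delta_{\mathbf e,\mathbf f}(x)=\sum_{i=1}^{q_1}\lfloor e_ix\rfloor-\sum_{j=1}^{q_2}\lfloor f_jx\rfloor\quad(x\in\mathbb R),\qquad \mathcal Q_{\mathbf e,\mathbf f}(n)=\frac{(e_1n)!\cdots(e_{q_1}n)!}{(f_1n)!\cdots(f_{q_2}n)!}\quad(n\ge 0),$$ and, with $H_m=\sum_{i=1}^m 1/i$, define the formal power series $$F_{\mathbf e,\mathbf f}(z)=\sum_{n\ge0}\mathcal Q_{\mathbf e,\mathbf f}(n)z^n,\qquad G_{\mathbf e,\mathbf f}(z)=\sum_{n\ge1}\mathcal Q_{\mathbf e,\mathbf f}(n)\Big(\sum_{i=1}^{q_1}e_iH_{e_in}-\sum_{j=1}^{q_2}f_jH_{f_jn}\Big)z^n,$$ $$q_{\mathbf e,\mathbf f}(z)=z\exp\big(G_{\mathbf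 e,\mathbf f}(z)/F_{\mathbf e,\mathbf f}(z)\big)\in\mathbb Q[[z]].$$ For a power series $u(z)$ with constant term $1$ and an integer $v\ge1$, $u(z)^{1/v}$ denotes the $v$-th root of $u(z)$ with constant term $1$. (1) Let $\mathbf e$ and $\mathbf f$ be two finite sequences of positive integers with no common element such that $|\mathbf e|=|\mathbf f|$, such that $\Delta_{\mathbf e,\mathbf f}(x)\ge1$ for every real $x\in[1/M_{\mathbf e,\mathbf f},1)$, and such that every element of $\mathbf e$ and of $\mathbf f$ divides $M_{\mathbf e,\mathbf f}$. Then $$\big(z^{-1}q_{\mathbf e,\mathbf f}(z)\big)^{1/M_{\mathbf e,\mathbf f}}\in\mathbb Z[[z]].$$ (2) (Zhou's conjecture.) Let $k_1,\dots,k_n$ be positive integers with $\frac1{k_1}+\cdots+\frac1{k_n}=1$, let $k=\operatorname{lcm}(k_1,\dots,k_n)$ and $w_i=k/k_i$ for $1\le i\le n$. Then, for $\mathbf e=(k)$ and $\mathbf f=(w_1,\dots,w_n)$, $$\big(z^{-1}q_{\mathbf e,\mathbf f}(z)\big)^{1/k}\in\mathbb Z[[z]].$$ -/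

import Mathlib

namespace MirrorMap

open PowerSeries

variable {q₁ q₂ : ℕ}

/-- `M_{e,f}`, the largest of all the terms of the two finite sequences `e` and `f`
(it is `0` when both sequences are empty). -/
def maxTerm (e : Fin q₁ → ℕ) (f : Fin q₂ → ℕ) : ℕ :=
  max (Finset.univ.sup e) (Finset.univ.sup f)

/-- The Landau function `Δ_{e,f}(x) = ∑ ⌊e_i x⌋ - ∑ ⌊f_j x⌋`. -/
noncomputable def landau (e : Fin q₁ → ℕ) (f : Fin q₂ → ℕ) (x : ℝ) : ℤ :=
  ∑ i, ⌊(e i : ℝ) * x⌋ - ∑ j, ⌊(f j : ℝ) * x⌋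

/-- The quotient of factorials `Q_{e,f}(n) = ∏ (e_i n)! / ∏ (f_j n)!`, a rational number. -/
def factRatio (e : Fin q₁ → ℕ) (f : Fin q₂ → ℕ) (n : ℕ) : ℚ :=
  (∏ i, ((e i * n).factorial : ℚ)) / ∏ j, ((f j * n).factorial : ℚ)

/-- The series `F_{e,f}(z) = ∑_{n ≥ 0} Q_{e,f}(n) z^n`. -/
def serF (e : Fin q₁ → ℕ) (f : Fin q₂ → ℕ) : ℚ⟦X⟧ :=
  PowerSeries.mk fun n => factRatio e f n

/-- The series `G_{e,f}(z) = ∑_{n ≥ 1} Q_{e,f}(n) (∑ e_i H_{e_i n} - ∑ f_j H_{f_j n}) z^n`.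
The term of index `n = 0` is zero because `H_0 = 0`. -/
def serG (e : Fin q₁ → ℕ) (f : Fin q₂ → ℕ) : ℚ⟦X⟧ :=
  PowerSeries.mk fun n => factRatio e f n *
    (∑ i, (e i : ℚ) * harmonic (e i * n) - ∑ j, (f j : ℚ) * harmonic (f j * n))

/-- The quotient `G_{e,f}(z) / F_{e,f}(z)`; `F_{e,f}` has constant term `1`. -/
noncomputable def serGdivF (e : Fin q₁ → ℕ) (f : Fin q₂ → ℕ) : ℚ⟦X⟧ :=
  serG e f * (serF e f)⁻¹

theorem constantCoeff_serF (e : Fin q₁ → ℕ) (f : Fin q₂ → ℕ) :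
    constantCoeff (serF e f) = 1 := by
  rw [← coeff_zero_eq_constantCoeff_apply]
  simp [serF, factRatio]

theorem constantCoeff_serGdivF (e : Fin q₁ → ℕ) (f : Fin q₂ → ℕ) :
    constantCoeff (serGdivF e f) = 0 := by
  have h : constantCoeff (serG e f) = 0 := by
    rw [← coeff_zero_eq_constantCoeff_apply]
    simp [serG]
  simp [serGdivF, h]

/-- The substitution of `G_{e,f} / F_{e,f}` into a power series is legitimate. -/
theorem hasSubst_serGdivF (e : Fin q₁ → ℕ) (f : Fin q₂ → ℕ) :
    HasSubst (serGdivF e f) :=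
  HasSubst.of_constantCoeff_zero' (constantCoeff_serGdivF e f)

/-- The canonical coordinate `q_{e,f}(z) = z exp(G_{e,f}(z) / F_{e,f}(z))`. -/
noncomputable def canonicalCoord (e : Fin q₁ → ℕ) (f : Fin q₂ → ℕ) : ℚ⟦X⟧ :=
  X * (PowerSeries.exp ℚ).subst (serGdivF e f)

/-- `z⁻¹ u(z)` for a power series `u` without constant term. -/
noncomputable def divZ (u : ℚ⟦X⟧) : ℚ⟦X⟧ :=
  PowerSeries.mk fun n => coeff (n + 1) u

/-- `u(z)^{1/v} ∈ ℤ⟦z⟧`, for a series `u` with constant term `1` and an integer `v ≥ 1`: here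
`u^{1/v}` is the `v`-th root of `u` with constant term `1` (the unique such series over `ℚ`),
and it is required to have integer coefficients. -/
def HasIntegralRoot (u : ℚ⟦X⟧) (v : ℕ) : Prop :=
  ∃ r : ℤ⟦X⟧, constantCoeff r = 1 ∧ (PowerSeries.map (Int.castRingHom ℚ) r) ^ v = u

end MirrorMap

/-! Work one prime p at a time. By Dwork's lemma, exp(u) has p-integral coefficients as soon as
u(z^p) - p u(z) has all its coefficients in pℤ₍ₚ₎. For u = G / (M F), multiplying by F(z) F(z^p),
which is invertible over ℤ₍ₚ₎, turns this into F(z) G(z^p) - p F(z^p) G(z) ∈ p M ℤ₍ₚ₎⟦z⟧. Now G is a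
combination, with coefficients ±L for L a term of e or f, of the series ∑ Q(n) H_{Ln} z^n. As L ∣ M,
it suffices that each such series gives a result divisible by p^(t+1), where t = v_p(M/L): this is
`Admissible.dworkMap_serHarmonic_mem`.

The coefficient of index a + pK is, up to terms estimated directly, -∑ H_{Lj} T_j with T_j = Q(a+pj)
Q(K-j) - Q(j) Q(a+p(K-j)), antisymmetric under j ↦ K - j. The core is a Dwork congruence,
`Admissible.dworkSum_mem`: the sum of T_j over the block [m p^s, (m+1) p^s) is divisible by
p^(s+1+μ(m)). Summation by parts along p-adic blocks then balances these sums against the poles of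
the harmonic numbers.

Here μ(n) counts the l ≥ 1 with {n/p^l} ≥ 1/M. Legendre's formula and the Landau hypothesis give
v_p(Q(n)) ≥ μ(n), and the same levels bound the poles of the differences of harmonic numbers, so
losses and gains match. Zhou's case only needs the Landau hypothesis, which follows from the
minimality of the lcm. -/

namespace MirrorMap

/-! ### p-adic valuations of rational numbers. -/

section PAdic

open Finset

/-- The additive group `p ^ r ℤ₍ₚ₎` of rational numbers of `p`-adic valuation at least `r`. -/
def pIdeal (p : ℕ) [Fact p.Prime] (r : ℤ) : AddSubgroup ℚ where
  -- `padicValRat p 0` is `0`, so zero has to be adjoined separately.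
  carrier := {x | x = 0 ∨ r ≤ padicValRat p x}
  zero_mem' := Or.inl rfl
  add_mem' := by
    rintro x y hx hy
    by_cases h : x + y = 0
    · exact Or.inl h
    rcases hx with rfl | hx
    · simpa using hy
    rcases hy with rfl | hy
    · simpa using Or.inr hx
    exact Or.inr ((le_min hx hy).trans (padicValRat.min_le_padicValRat_add h))
  neg_mem' := by
    rintro x hx
    simpa using hx

section pIdeal

variable {p : ℕ} [hp : Fact p.Prime] {r s : ℤ} {x y : ℚ}

theorem mem_pIdeal_of_le (h : r ≤ padicValRat p x) : x ∈ pIdeal p r := Or.inr h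

theorem le_padicValRat_of_mem (h0 : x ≠ 0) (h : x ∈ pIdeal p r) : r ≤ padicValRat p x :=
  h.resolve_left h0

theorem pIdeal_mono (h : s ≤ r) (hx : x ∈ pIdeal p r) : x ∈ pIdeal p s :=
  hx.imp id h.trans

theorem mul_mem_pIdeal (hx : x ∈ pIdeal p r) (hy : y ∈ pIdeal p s) :
    x * y ∈ pIdeal p (r + s) := by
  by_cases hx0 : x = 0
  · simp [hx0, zero_mem]
  by_cases hy0 : y = 0
  · simp [hy0, zero_mem]
  refine mem_pIdeal_of_le ?_
  rw [padicValRat.mul hx0 hy0]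
  exact add_le_add (le_padicValRat_of_mem hx0 hx) (le_padicValRat_of_mem hy0 hy)

theorem mul_mem_pIdeal_of_eq {t : ℤ} (hx : x ∈ pIdeal p r) (hy : y ∈ pIdeal p s)
    (h : t ≤ r + s) : x * y ∈ pIdeal p t :=
  pIdeal_mono h (mul_mem_pIdeal hx hy)

theorem div_mem_pIdeal (hx : x ∈ pIdeal p r) (hy : padicValRat p y ≤ s) :
    x / y ∈ pIdeal p (r - s) := by
  rw [div_eq_mul_inv, sub_eq_add_neg]
  refine mul_mem_pIdeal hx (mem_pIdeal_of_le ?_)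
  rw [padicValRat.inv]
  exact neg_le_neg hy

theorem natCast_mem_pIdeal (n : ℕ) : (n : ℚ) ∈ pIdeal p 0 :=
  mem_pIdeal_of_le (by simp)

theorem one_mem_pIdeal : (1 : ℚ) ∈ pIdeal p 0 := by
  exact_mod_cast natCast_mem_pIdeal (p := p) 1

theorem intCast_mem_pIdeal_of_dvd {k : ℕ} {n : ℤ} (h : (p : ℤ) ^ k ∣ n) :
    (n : ℚ) ∈ pIdeal p k := by
  by_cases h0 : n = 0
  · simp [h0, zero_mem]
  refine mem_pIdeal_of_le ?_
  rw [padicValRat.of_int]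
  exact_mod_cast ((padicValInt_dvd_iff k n).1 (by exact_mod_cast h)).resolve_left h0

theorem prime_zpow_mem_pIdeal (k : ℤ) : (p : ℚ) ^ k ∈ pIdeal p k :=
  mem_pIdeal_of_le (by simp [padicValRat.zpow])

theorem prime_pow_mem_pIdeal (k : ℕ) : (p : ℚ) ^ k ∈ pIdeal p k := by
  exact_mod_cast prime_zpow_mem_pIdeal (p := p) k

theorem prime_mem_pIdeal : (p : ℚ) ∈ pIdeal p 1 := by
  simpa using prime_zpow_mem_pIdeal (p := p) 1

theorem prime_inv_mem_pIdeal : (p : ℚ)⁻¹ ∈ pIdeal p (-1) := by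
  simpa using prime_zpow_mem_pIdeal (p := p) (-1)

theorem natCast_inv_mem_pIdeal {n : ℕ} {k : ℤ} (h : (padicValNat p n : ℤ) ≤ k) :
    (n : ℚ)⁻¹ ∈ pIdeal p (-k) :=
  mem_pIdeal_of_le (by rw [padicValRat.inv, padicValRat.of_nat]; exact neg_le_neg h)

theorem natCast_inv_mem_pIdeal_zero {n : ℕ} (h : ¬ p ∣ n) : (n : ℚ)⁻¹ ∈ pIdeal p 0 := by
  simpa using natCast_inv_mem_pIdeal (p := p) (n := n) (k := 0)
    (by rw [padicValNat.eq_zero_of_not_dvd h]; rfl)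

theorem mul_mem_pIdeal_zero (hx : x ∈ pIdeal p 0) (hy : y ∈ pIdeal p r) :
    x * y ∈ pIdeal p r := by
  simpa using mul_mem_pIdeal hx hy

theorem pow_mem_pIdeal_zero (hx : x ∈ pIdeal p 0) (n : ℕ) : x ^ n ∈ pIdeal p 0 := by
  induction n with
  | zero => simpa using one_mem_pIdeal
  | succ n ih => rw [pow_succ]; exact mul_mem_pIdeal_zero ih hx

theorem not_dvd_den_of_mem (hx : x ∈ pIdeal p 0) : ¬ p ∣ x.den := by
  intro hd
  have hx0 : x ≠ 0 := by
    rintro rfl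
    exact hp.out.one_lt.ne' (Nat.dvd_one.1 hd)
  have h1 := le_padicValRat_of_mem hx0 hx
  rw [padicValRat_def] at h1
  have h2 : padicValInt p x.num = 0 := by
    refine padicValInt.eq_zero_of_not_dvd fun hn => ?_
    have := Nat.dvd_gcd (Int.natCast_dvd.1 hn) hd
    rw [x.reduced.gcd_eq_one] at this
    exact hp.out.one_lt.ne' (Nat.dvd_one.1 this)
  have h3 := one_le_padicValNat_of_dvd x.den_nz hd
  omega

/-- A denominator without prime divisors is 1; this glues the local results at the end. -/
theorem exists_int_of_forall_mem_pIdeal (h : ∀ (p : ℕ) [Fact p.Prime], x ∈ pIdeal p 0) :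
    ∃ n : ℤ, (n : ℚ) = x := by
  refine ⟨x.num, (Rat.den_eq_one_iff x).1 ?_⟩
  by_contra hd
  obtain ⟨q, hq, hqd⟩ := Nat.exists_prime_and_dvd hd
  have := Fact.mk hq
  exact not_dvd_den_of_mem (h q) hqd

/-- A rational number congruent to `1` modulo `p ^ c`, `c ≥ 1`, has valuation zero. -/
theorem padicValRat_eq_zero_of_sub_one_mem {c : ℤ} (hc : 1 ≤ c) (hx : x - 1 ∈ pIdeal p c) :
    x ≠ 0 ∧ padicValRat p x = 0 := by
  have hx1 : x - 1 ∈ pIdeal p 1 := pIdeal_mono hc hx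
  have h0 : x ≠ 0 := by
    rintro rfl
    have := le_padicValRat_of_mem (by norm_num) hx1
    simp at this
  refine ⟨h0, ?_⟩
  have hge : 0 ≤ padicValRat p x := by
    refine le_padicValRat_of_mem h0 ?_
    simpa using add_mem (pIdeal_mono (by norm_num) hx1) one_mem_pIdeal
  by_contra hne
  have h1 : x ∈ pIdeal p 1 := mem_pIdeal_of_le (by omega)
  have := le_padicValRat_of_mem (by norm_num) (sub_mem h1 hx1)
  simp at this

theorem mul_sub_one_mem {c : ℤ} (hc : 1 ≤ c) (hx : x - 1 ∈ pIdeal p c) (hy : y - 1 ∈ pIdeal p c) :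
    x * y - 1 ∈ pIdeal p c := by
  have : x * y - 1 = y * (x - 1) + (y - 1) := by ring
  rw [this]
  have hv := (padicValRat_eq_zero_of_sub_one_mem hc hy).2
  exact add_mem (mul_mem_pIdeal_zero (mem_pIdeal_of_le hv.ge) hx) hy

theorem inv_sub_one_mem {c : ℤ} (hc : 1 ≤ c) (hx : x - 1 ∈ pIdeal p c) :
    x⁻¹ - 1 ∈ pIdeal p c := by
  obtain ⟨h0, hv⟩ := padicValRat_eq_zero_of_sub_one_mem hc hx
  have : x⁻¹ - 1 = x⁻¹ * -(x - 1) := by field_simp; ring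
  rw [this]
  refine mul_mem_pIdeal_zero (mem_pIdeal_of_le ?_) (neg_mem hx)
  rw [padicValRat.inv, hv, neg_zero]

theorem prod_sub_one_mem {ι : Type*} {t : Finset ι} {g : ι → ℚ} {c : ℤ} (hc : 1 ≤ c)
    (h : ∀ i ∈ t, g i - 1 ∈ pIdeal p c) : ∏ i ∈ t, g i - 1 ∈ pIdeal p c := by
  induction t using Finset.cons_induction with
  | empty => simp [zero_mem]
  | cons a t ha ih =>
    rw [prod_cons]
    exact mul_sub_one_mem hc (h a (mem_cons_self a t))
      (ih fun i hi => h i (mem_cons_of_mem hi))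

end pIdeal

end PAdic

/-! ### Levels of an integer and valuations of the factorial ratios. -/

section Levels

open Finset

/-- The levels `l ≥ 1` at which the fractional part of `n / p ^ l` is at least `1 / M`. -/
def levels (p M n : ℕ) : Finset ℕ := (Icc 1 (M * n)).filter fun l => p ^ l ≤ M * (n % p ^ l)

/-- The number of levels of `n`. -/
def mu (p M n : ℕ) : ℕ := #(levels p M n)

/-- The number of levels of `n` which are at most `t`. -/
def muUpTo (p M t n : ℕ) : ℕ := #((levels p M n).filter (· ≤ t))

section levels

variable {p M : ℕ}

theorem muUpTo_le_mu (t n : ℕ) : muUpTo p M t n ≤ mu p M n := card_filter_le _ _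

theorem add_mul_pow_mod {u m t l : ℕ} (hl : l ≤ t) :
    (u + m * p ^ t) % p ^ l = u % p ^ l := by
  obtain ⟨c, rfl⟩ := Nat.exists_eq_add_of_le hl
  rw [show u + m * p ^ (l + c) = u + p ^ l * (m * p ^ c) by ring, Nat.add_mul_mod_self_left]

variable [hp : Fact p.Prime]

/-- The bound `M * n` in the definition excludes nothing: a level satisfies l < p^l ≤ M (n mod p^l)
≤ M n. -/
theorem mem_levels {n l : ℕ} : l ∈ levels p M n ↔ 1 ≤ l ∧ p ^ l ≤ M * (n % p ^ l) := by
  simp only [levels, mem_filter, mem_Icc, and_assoc, and_congr_right_iff, and_iff_right_iff_imp]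
  intro _ h
  exact (Nat.lt_pow_self hp.out.one_lt).le.trans
    (h.trans (Nat.mul_le_mul_left _ (Nat.mod_le _ _)))

theorem mod_prime_pow_add {u m t l : ℕ} (hu : u < p ^ t) :
    (u + m * p ^ t) % p ^ (l + t) = u + m % p ^ l * p ^ t := by
  have h1 : u + m * p ^ t = u + m % p ^ l * p ^ t + p ^ (l + t) * (m / p ^ l) := by
    conv_lhs => rw [← Nat.mod_add_div m (p ^ l)]
    ring
  have hm := Nat.mod_lt m (pow_pos hp.out.pos l)
  rw [h1, Nat.add_mul_mod_self_left, Nat.mod_eq_of_lt]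
  calc u + m % p ^ l * p ^ t < (m % p ^ l + 1) * p ^ t := by rw [add_mul, one_mul]; omega
    _ ≤ p ^ l * p ^ t := Nat.mul_le_mul_right _ hm
    _ = _ := by ring

theorem add_mem_levels {u m t l : ℕ} (hu : u < p ^ t) (hl : l ∈ levels p M m) :
    l + t ∈ levels p M (u + m * p ^ t) := by
  rw [mem_levels] at *
  refine ⟨by omega, ?_⟩
  rw [mod_prime_pow_add hu, pow_add]
  calc p ^ l * p ^ t ≤ M * (m % p ^ l) * p ^ t := Nat.mul_le_mul_right _ hl.2
    _ ≤ M * (u + m % p ^ l * p ^ t) := by rw [mul_assoc]; exact Nat.mul_le_mul_left _ (by omega)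

/-- The low digits of `u + m * p ^ t` are those of `u`, and the levels of `m` reappear shifted by
`t`; the two families are disjoint. -/
theorem muUpTo_add_mu_le {u m t : ℕ} (hu : u < p ^ t) :
    muUpTo p M t u + mu p M m ≤ mu p M (u + m * p ^ t) := by
  have h2 : mu p M m = #((levels p M m).image (· + t)) :=
    (card_image_of_injective _ (add_left_injective t)).symm
  rw [h2, muUpTo, ← card_union_of_disjoint]
  · refine card_le_card (union_subset (fun l hl => ?_) (fun l hl => ?_))
    · rw [mem_filter, mem_levels] at hl
      rw [mem_levels, add_mul_pow_mod hl.2]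
      exact hl.1
    · obtain ⟨l', hl', rfl⟩ := mem_image.1 hl
      exact add_mem_levels hu hl'
  · rw [disjoint_left]
    intro l hl hl'
    obtain ⟨l'', hl'', rfl⟩ := mem_image.1 hl'
    have := (mem_filter.1 hl).2
    have := (mem_levels.1 hl'').1
    omega

/-- If all the levels up to `t` occur, then `muUpTo` is at least `t`. -/
theorem le_muUpTo {t r n : ℕ} (hr : r ≤ t) (h : ∀ l, 1 ≤ l → l ≤ r → p ^ l ≤ M * (n % p ^ l)) :
    r ≤ muUpTo p M t n := by
  calc r = #(Icc 1 r) := by simp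
    _ ≤ _ := card_le_card fun l hl => by
      rw [mem_Icc] at hl
      exact mem_filter.2 ⟨mem_levels.2 ⟨hl.1, h l hl.1 hl.2⟩, hl.2.trans hr⟩

theorem le_mu_of_levels {r n : ℕ} (h : ∀ l, 1 ≤ l → l ≤ r → p ^ l ≤ M * (n % p ^ l)) :
    r ≤ mu p M n :=
  (le_muUpTo le_rfl h).trans (muUpTo_le_mu r n)

/-- When appending the digit i carries j across the threshold 1/M, every level up to x+1 occurs.
Removing the low part of u = i + pj leaves a multiple of p^(l+1) by an integer v = ⌊j/p^l⌋ with M v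
≤ p^(x-l) - 1, so the low part must supply at least p^(l+1) of M u ≥ p^(x+1). -/
theorem muUpTo_add_digit {j i x : ℕ} (hj : M * j < p ^ x) (hi : p ^ (x + 1) ≤ M * (i + p * j))
    (hip : i < p) : x + 1 ≤ muUpTo p M (x + 1) (i + p * j) := by
  refine le_muUpTo le_rfl fun l hl hlx => ?_
  set u := i + p * j with hu
  obtain ⟨l, rfl⟩ := Nat.exists_eq_add_of_le' hl
  have h1 : u / p ^ (l + 1) = j / p ^ l := by
    rw [pow_succ', ← Nat.div_div_eq_div_mul, hu, Nat.add_mul_div_left _ _ hp.out.pos,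
      Nat.div_eq_of_lt hip, zero_add]
  have h2 := Nat.mod_add_div u (p ^ (l + 1))
  rw [h1] at h2
  have h3 : M * (j / p ^ l) < p ^ (x - l) := by
    by_contra! h
    have : p ^ x ≤ M * j := calc
      p ^ x = p ^ (x - l) * p ^ l := by rw [← pow_add]; congr 1; omega
      _ ≤ M * (j / p ^ l) * p ^ l := Nat.mul_le_mul_right _ h
      _ ≤ M * j := by rw [mul_assoc]; exact Nat.mul_le_mul_left _ (Nat.div_mul_le_self _ _)
    omega
  have h4 : p ^ (l + 1) * (M * (j / p ^ l) + 1) ≤ p ^ (x + 1) := calc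
    _ ≤ p ^ (l + 1) * p ^ (x - l) := Nat.mul_le_mul_left _ h3
    _ = p ^ (x + 1) := by rw [← pow_add]; congr 1; omega
  have h5 : M * u = M * (u % p ^ (l + 1)) + p ^ (l + 1) * (M * (j / p ^ l)) := by
    conv_lhs => rw [← h2]
    ring
  rw [mul_add, mul_one] at h4
  omega

/-- The residue of `a + p * j` modulo `p ^ l` is at least `p ^ l / L` when `p ^ (l - 1)` divides
`L * j + ε` for some `1 ≤ ε ≤ L * a / p`. -/
theorem pow_le_mul_mod {L a j ε r l : ℕ} (ha : a < p) (hε : 1 ≤ ε) (hε' : ε ≤ L * a / p)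
    (hr : p ^ r ∣ L * j + ε) (hl : 1 ≤ l) (hlr : l ≤ r + 1) :
    p ^ l ≤ L * ((a + p * j) % p ^ l) := by
  obtain ⟨l, rfl⟩ := Nat.exists_eq_add_of_le' hl
  have hp0 := hp.out.pos
  have h1 : (a + p * j) % p ^ (l + 1) = a + p * (j % p ^ l) := by
    have := mod_prime_pow_add (p := p) (u := a) (m := j) (t := 1) (l := l) (by simpa using ha)
    rw [pow_one] at this
    rw [mul_comm p j, this, mul_comm]
  have h2 : p ^ l ∣ L * (j % p ^ l) + ε := by
    have h3 : p ^ l ∣ L * j + ε := (pow_dvd_pow p (by omega)).trans hr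
    have h4 : L * j + ε = L * (j % p ^ l) + ε + p ^ l * (L * (j / p ^ l)) := by
      conv_lhs => rw [← Nat.mod_add_div j (p ^ l)]
      ring
    rw [h4] at h3
    exact (Nat.dvd_add_left (dvd_mul_right _ _)).1 h3
  -- A multiple of p^l that is positive, thanks to ε ≥ 1, is at least p^l.
  have h5 := Nat.le_of_dvd (by omega) h2
  have h6 : p * ε ≤ L * a := (Nat.mul_le_mul_left p hε').trans (Nat.mul_div_le _ _)
  rw [h1]
  calc p ^ (l + 1) = p * p ^ l := by ring
    _ ≤ p * (L * (j % p ^ l) + ε) := Nat.mul_le_mul_left _ h5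
    _ ≤ L * (a + p * (j % p ^ l)) := by nlinarith

/-- The factors Lj + ε with 1 ≤ ε ≤ ⌊La/p⌋ are those separating (Lj)! from ⌊L(a+pj)/p⌋!; a high
power of p in one of them forces many levels. -/
theorem muUpTo_of_dvd {L a j ε r t : ℕ} (hLM : L ≤ M) (ha : a < p) (hε : 1 ≤ ε)
    (hε' : ε ≤ L * a / p) (hr : p ^ r ∣ L * j + ε) (ht : r + 1 ≤ t) :
    r + 1 ≤ muUpTo p M t (a + p * j) :=
  le_muUpTo ht fun _ hl hlr =>
    (pow_le_mul_mod ha hε hε' hr hl hlr).trans (Nat.mul_le_mul_right _ hLM)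

/-- A factor p^t to spare in M prolongs the run of levels by t: each further level multiplies the
threshold by p only. -/
theorem mu_of_dvd {L a j ε r t : ℕ} (hLM : p ^ t * L ≤ M) (ha : a < p) (hε : 1 ≤ ε)
    (hε' : ε ≤ L * a / p) (hr : p ^ r ∣ L * j + ε) :
    r + 1 + t ≤ mu p M (a + p * j) := by
  have hp0 := hp.out.pos
  refine le_mu_of_levels fun l hl hlr => ?_
  by_cases h : l ≤ r + 1
  · refine (pow_le_mul_mod ha hε hε' hr hl h).trans (Nat.mul_le_mul_right _ (le_trans ?_ hLM))
    exact Nat.le_mul_of_pos_left _ (by positivity)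
  · obtain ⟨c, rfl⟩ := Nat.exists_eq_add_of_le (not_le.1 h).le
    have h1 := pow_le_mul_mod ha hε hε' hr (by omega) (le_refl (r + 1))
    have h2 : (a + p * j) % p ^ (r + 1) ≤ (a + p * j) % p ^ (r + 1 + c) := by
      rw [← Nat.mod_mod_of_dvd (a + p * j) (pow_dvd_pow p (Nat.le_add_right (r + 1) c))]
      exact Nat.mod_le _ _
    calc p ^ (r + 1 + c) = p ^ c * p ^ (r + 1) := by ring
      _ ≤ p ^ c * (L * ((a + p * j) % p ^ (r + 1 + c))) :=
        Nat.mul_le_mul_left _ (h1.trans (Nat.mul_le_mul_left _ h2))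
      _ ≤ p ^ t * L * ((a + p * j) % p ^ (r + 1 + c)) := by
        rw [← mul_assoc]
        exact Nat.mul_le_mul_right _ (Nat.mul_le_mul_right _ (Nat.pow_le_pow_right hp0 (by omega)))
      _ ≤ _ := Nat.mul_le_mul_right _ hLM

/-- With x = v_p(n), the residue of n modulo p^l is a nonzero multiple of p^x for every l > x, so
x+1, …, x+t are levels. -/
theorem le_mu_of_pow_le {t n : ℕ} (hM : p ^ t ≤ M) (hn : n ≠ 0) : t ≤ mu p M n := by
  have hp0 := hp.out.pos
  set x := padicValNat p n
  calc t = #(Icc (x + 1) (x + t)) := by simp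
    _ ≤ _ := card_le_card fun l hl => ?_
  rw [mem_Icc] at hl
  rw [mem_levels]
  refine ⟨by omega, ?_⟩
  have hdvd : p ^ x ∣ n % p ^ l :=
    (Nat.dvd_mod_iff (pow_dvd_pow p (by omega))).2 pow_padicValNat_dvd
  have hne : n % p ^ l ≠ 0 := fun h =>
    pow_succ_padicValNat_not_dvd (p := p) hn
      ((pow_dvd_pow p hl.1).trans (Nat.dvd_of_mod_eq_zero h))
  calc p ^ l ≤ p ^ (x + t) := Nat.pow_le_pow_right hp0 hl.2
    _ = p ^ t * p ^ x := by ring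
    _ ≤ M * (n % p ^ l) := Nat.mul_le_mul hM (Nat.le_of_dvd (Nat.pos_of_ne_zero hne) hdvd)

theorem muUpTo_eq_mu {n t : ℕ} (h : M * n < p ^ (t + 1)) : muUpTo p M t n = mu p M n := by
  rw [muUpTo, filter_true_of_mem, mu]
  intro l hl
  by_contra! hlt
  have h1 := (mem_levels.1 hl).2
  have h2 : p ^ (t + 1) ≤ p ^ l := Nat.pow_le_pow_right hp.out.pos hlt
  have h3 := Nat.mul_le_mul_left M (Nat.mod_le n (p ^ l))
  omega

end levels

variable {q₁ q₂ : ℕ}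

/-- The hypotheses on `e`, `f` and `M` used below: `∑ e_i = ∑ f_j`, all terms are at most `M`, and
the Landau function is at least `1` at the fractions `r / q ∈ [1 / M, 1)`. -/
structure Admissible (e : Fin q₁ → ℕ) (f : Fin q₂ → ℕ) (M : ℕ) : Prop where
  pos : 0 < M
  left_le : ∀ i, e i ≤ M
  right_le : ∀ j, f j ≤ M
  sum_eq : ∑ i, e i = ∑ j, f j
  one_le : ∀ q r, r < q → q ≤ M * r → ∑ j, f j * r / q + 1 ≤ ∑ i, e i * r / q

/-- The Landau function at `n / q`. -/
def landauDiv (e : Fin q₁ → ℕ) (f : Fin q₂ → ℕ) (q n : ℕ) : ℤ :=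
  ∑ i, ((e i * n / q : ℕ) : ℤ) - ∑ j, ((f j * n / q : ℕ) : ℤ)

section valuation

variable {e : Fin q₁ → ℕ} {f : Fin q₂ → ℕ} {M : ℕ}

theorem factRatio_ne_zero (e : Fin q₁ → ℕ) (f : Fin q₂ → ℕ) (n : ℕ) : factRatio e f n ≠ 0 := by
  rw [factRatio]
  refine div_ne_zero ?_ ?_ <;>
  exact prod_ne_zero_iff.2 fun i _ => by exact_mod_cast Nat.factorial_ne_zero _

theorem factRatio_zero (e : Fin q₁ → ℕ) (f : Fin q₂ → ℕ) : factRatio e f 0 = 1 := by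
  simp [factRatio]

/-- The equality ∑ e_i = ∑ f_j makes the Landau function 1-periodic. -/
theorem Admissible.landauDiv_mod (h : Admissible e f M) {q : ℕ} (hq : 0 < q) (n : ℕ) :
    landauDiv e f q n = landauDiv e f q (n % q) := by
  have key (c : ℕ) : c * n / q = c * (n % q) / q + c * (n / q) := by
    conv_lhs => rw [← Nat.mod_add_div n q]
    rw [mul_add, show c * (q * (n / q)) = q * (c * (n / q)) by ring,
      Nat.add_mul_div_left _ _ hq]
  have hs : (∑ i, (e i : ℤ)) = ∑ j, (f j : ℤ) := by exact_mod_cast h.sum_eq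
  simp only [landauDiv, key]
  push_cast
  simp only [sum_add_distrib, ← sum_mul, hs]
  ring

theorem Admissible.one_le_landauDiv (h : Admissible e f M) {q n : ℕ} (hq : 0 < q)
    (hn : q ≤ M * (n % q)) : 1 ≤ landauDiv e f q n := by
  rw [h.landauDiv_mod hq]
  have := h.one_le q (n % q) (Nat.mod_lt _ hq) hn
  have : ((∑ j, f j * (n % q) / q + 1 : ℕ) : ℤ) ≤ ((∑ i, e i * (n % q) / q : ℕ) : ℤ) := by
    exact_mod_cast this
  push_cast at this
  simp only [landauDiv]
  push_cast
  linarith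

theorem Admissible.landauDiv_eq_zero (h : Admissible e f M) {q n : ℕ}
    (hn : M * (n % q) < q) : landauDiv e f q n = 0 := by
  have hq : 0 < q := by omega
  rw [h.landauDiv_mod hq]
  have key (c : ℕ) (hc : c ≤ M) : c * (n % q) / q = 0 :=
    Nat.div_eq_of_lt ((Nat.mul_le_mul_right _ hc).trans_lt hn)
  simp [landauDiv, key _ (h.left_le _), key _ (h.right_le _)]

theorem Admissible.landauDiv_nonneg (h : Admissible e f M) {q : ℕ} (hq : 0 < q) (n : ℕ) :
    0 ≤ landauDiv e f q n := by
  rcases lt_or_ge (M * (n % q)) q with h1 | h1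
  · exact (h.landauDiv_eq_zero h1).ge
  · exact zero_le_one.trans (h.one_le_landauDiv hq h1)

variable {p : ℕ} [hp : Fact p.Prime]

theorem padicValRat_prod {ι : Type*} (t : Finset ι) (g : ι → ℚ) (hg : ∀ i ∈ t, g i ≠ 0) :
    padicValRat p (∏ i ∈ t, g i) = ∑ i ∈ t, padicValRat p (g i) := by
  induction t using Finset.cons_induction with
  | empty => simp
  | cons a t ha ih =>
    rw [prod_cons, sum_cons, padicValRat.mul (hg a (mem_cons_self a t)), ih]
    · exact fun i hi => hg i (mem_cons_of_mem hi)
    · exact prod_ne_zero_iff.2 fun i hi => hg i (mem_cons_of_mem hi)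

theorem Admissible.padicValRat_factRatio (h : Admissible e f M) {n b : ℕ} (hb : M * n < b) :
    padicValRat p (factRatio e f n) = ∑ l ∈ Ico 1 b, landauDiv e f (p ^ l) n := by
  have key (c : ℕ) (hc : c ≤ M) :
      padicValRat p ((c * n).factorial : ℚ) = ∑ l ∈ Ico 1 b, ((c * n / p ^ l : ℕ) : ℤ) := by
    rw [padicValRat.of_nat, padicValNat_factorial (b := b)]
    · push_cast
      rfl
    · have := Nat.log_le_self p (c * n)
      have := Nat.mul_le_mul_right n hc
      omega
  have h0 (k : ℕ) : (k.factorial : ℚ) ≠ 0 := by exact_mod_cast Nat.factorial_ne_zero _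
  rw [factRatio, padicValRat.div (prod_ne_zero_iff.2 fun i _ => h0 _)
    (prod_ne_zero_iff.2 fun i _ => h0 _), padicValRat_prod _ _ fun i _ => h0 _,
    padicValRat_prod _ _ fun i _ => h0 _]
  simp only [landauDiv, sum_sub_distrib]
  rw [sum_comm, sum_comm (s := Ico 1 b)]
  congr 1
  · exact sum_congr rfl fun i _ => key _ (h.left_le i)
  · exact sum_congr rfl fun i _ => key _ (h.right_le i)

theorem Admissible.card_le_sum_landauDiv (h : Admissible e f M) {n : ℕ} {s t : Finset ℕ}
    (hs : s ⊆ levels p M n) (hst : s ⊆ t) : (#s : ℤ) ≤ ∑ l ∈ t, landauDiv e f (p ^ l) n := by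
  have hpos (l : ℕ) : 0 < p ^ l := pow_pos hp.out.pos l
  calc (#s : ℤ) = ∑ l ∈ s, 1 := by simp
    _ ≤ ∑ l ∈ s, landauDiv e f (p ^ l) n :=
      sum_le_sum fun l hl => h.one_le_landauDiv (hpos l) (mem_levels.1 (hs hl)).2
    _ ≤ _ := sum_le_sum_of_subset_of_nonneg hst fun l _ _ => h.landauDiv_nonneg (hpos l) n

theorem Admissible.mu_le_padicValRat (h : Admissible e f M) (n : ℕ) :
    (mu p M n : ℤ) ≤ padicValRat p (factRatio e f n) := by
  rw [h.padicValRat_factRatio (Nat.lt_succ_self _)]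
  refine h.card_le_sum_landauDiv subset_rfl fun l hl => ?_
  have h1 := mem_Icc.1 (mem_filter.1 hl).1
  exact mem_Ico.2 ⟨h1.1, Nat.lt_succ_of_le h1.2⟩

theorem Admissible.factRatio_mem (h : Admissible e f M) (n : ℕ) :
    factRatio e f n ∈ pIdeal p (mu p M n) :=
  mem_pIdeal_of_le (h.mu_le_padicValRat n)

theorem Admissible.factRatio_mem_zero (h : Admissible e f M) (n : ℕ) :
    factRatio e f n ∈ pIdeal p 0 :=
  pIdeal_mono (by positivity) (h.factRatio_mem n)

/-- In Legendre's formula the terms l ≤ t agree for j + m p^t and j, and those of j vanish for l > t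
because M j < p^t. What remains is bounded below by the shifted levels of m. -/
theorem Admissible.factRatio_add_div_mem (h : Admissible e f M) {j m t : ℕ} (hj : M * j < p ^ t) :
    factRatio e f (j + m * p ^ t) / factRatio e f j ∈ pIdeal p (mu p M m) := by
  have hjt : j < p ^ t := (Nat.le_mul_of_pos_left j h.pos).trans_lt hj
  refine mem_pIdeal_of_le ?_
  rw [padicValRat.div (factRatio_ne_zero e f _) (factRatio_ne_zero e f _)]
  set n := j + m * p ^ t with hn
  have hb : M * n < M * n + t + 1 := by omega
  have hb' : M * j < M * n + t + 1 := by
    have : M * j ≤ M * n := Nat.mul_le_mul_left _ (by omega)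
    omega
  rw [h.padicValRat_factRatio hb, h.padicValRat_factRatio hb',
    ← sum_Ico_consecutive _ (show 1 ≤ t + 1 by omega) (show t + 1 ≤ M * n + t + 1 by omega),
    ← sum_Ico_consecutive _ (show 1 ≤ t + 1 by omega) (show t + 1 ≤ M * n + t + 1 by omega)]
  have h1 : ∑ l ∈ Ico 1 (t + 1), landauDiv e f (p ^ l) n
      = ∑ l ∈ Ico 1 (t + 1), landauDiv e f (p ^ l) j := by
    refine sum_congr rfl fun l hl => ?_
    have hpos : 0 < p ^ l := pow_pos hp.out.pos l
    rw [h.landauDiv_mod hpos, h.landauDiv_mod hpos j, hn,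
      add_mul_pow_mod (by rw [mem_Ico] at hl; omega)]
  have h2 : ∑ l ∈ Ico (t + 1) (M * n + t + 1), landauDiv e f (p ^ l) j = 0 := by
    refine sum_eq_zero fun l hl => h.landauDiv_eq_zero ?_
    calc M * (j % p ^ l) ≤ M * j := Nat.mul_le_mul_left _ (Nat.mod_le _ _)
      _ < p ^ t := hj
      _ ≤ p ^ l := Nat.pow_le_pow_right hp.out.pos (by rw [mem_Ico] at hl; omega)
  have h3 : (mu p M m : ℤ) ≤ ∑ l ∈ Ico (t + 1) (M * n + t + 1), landauDiv e f (p ^ l) n := by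
    rw [mu, ← card_image_of_injective (levels p M m) (add_left_injective t)]
    refine h.card_le_sum_landauDiv (fun l hl => ?_) (fun l hl => ?_)
    · obtain ⟨l', hl', rfl⟩ := mem_image.1 hl
      exact add_mem_levels hjt hl'
    · obtain ⟨l', hl', rfl⟩ := mem_image.1 hl
      have h1 : 1 ≤ l' + t ∧ l' + t ≤ M * n :=
        mem_Icc.1 (mem_filter.1 (add_mem_levels hjt hl')).1
      have h2 := (mem_levels.1 hl').1
      exact mem_Ico.2 ⟨by omega, by omega⟩
  rw [h1, h2]
  linarith

end valuation

end Levels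

/-! ### Congruences between quotients of factorial ratios. -/

section Factorials

open Finset

/-- The product of the positive integers up to `n` which are not divisible by `p`. -/
def unitFactorial (p n : ℕ) : ℕ := ∏ k ∈ range n, if p ∣ k + 1 then 1 else k + 1

section unitFactorial

variable {p : ℕ}

/-- Each block of q consecutive integers contributes the same unit modulo q. Its value is not
needed: it will cancel between e and f. -/
theorem unitFactorial_add_mul_modEq {q : ℕ} (hq : p ∣ q) (x y : ℕ) :
    unitFactorial p (x + y * q) ≡ unitFactorial p x * unitFactorial p q ^ y [MOD q] := by
  have step (x : ℕ) :
      unitFactorial p (q + x) ≡ unitFactorial p q * unitFactorial p x [MOD q] := by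
    rw [unitFactorial, prod_range_add]
    refine Nat.ModEq.mul_left _ ?_
    rw [unitFactorial]
    refine Nat.ModEq.prod fun k _ => ?_
    have : p ∣ q + k + 1 ↔ p ∣ k + 1 := by rw [add_assoc]; exact Nat.dvd_add_right hq
    simp only [this]
    split_ifs
    · rfl
    · rw [add_assoc]
      exact Nat.add_modEq_left
  induction y with
  | zero => simp [Nat.ModEq.refl]
  | succ y ih =>
    rw [show x + (y + 1) * q = q + (x + y * q) by ring]
    refine (step _).trans ((ih.mul_left _).trans ?_)
    rw [pow_succ]
    exact congrArg (· % q) (by ring)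

theorem factorial_eq_unitFactorial_mul (n : ℕ) :
    n.factorial = unitFactorial p n * p ^ (n / p) * (n / p).factorial := by
  induction n with
  | zero => simp [unitFactorial]
  | succ n ih =>
    rw [Nat.factorial_succ, ih, unitFactorial, unitFactorial, prod_range_succ, Nat.succ_div]
    split_ifs with h
    · have h1 : n + 1 = p * (n / p + 1) := by
        have := Nat.succ_div_of_dvd h
        rw [← Nat.succ_eq_add_one (n / p), Nat.succ_eq_add_one, ← this, Nat.mul_div_cancel' h]
      rw [Nat.factorial_succ, pow_succ, mul_one]
      conv_lhs => rw [h1]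
      ring
    · rw [add_zero]
      ring

variable [hp : Fact p.Prime]

theorem not_dvd_unitFactorial (n : ℕ) : ¬ p ∣ unitFactorial p n := by
  rw [unitFactorial, hp.out.prime.dvd_finsetProd_iff]
  rintro ⟨k, _, hk⟩
  split_ifs at hk with h
  · exact hp.out.one_lt.ne' (Nat.dvd_one.1 hk)
  · exact h hk

theorem factorial_mul_add (c J : ℕ) (a : ℕ) :
    ((c * (a + p * J)).factorial : ℚ) =
      unitFactorial p (c * (a + p * J)) * (p ^ (c * a / p) * (p ^ J) ^ c) * (c * J).factorial *
        ∏ ε ∈ range (c * a / p), ((c * J + 1 + ε : ℕ) : ℚ) := by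
  have h1 : c * (a + p * J) / p = c * J + c * a / p := by
    rw [show c * (a + p * J) = c * a + p * (c * J) by ring, Nat.add_mul_div_left _ _ hp.out.pos,
      add_comm]
  rw [factorial_eq_unitFactorial_mul (p := p), h1, ← Nat.factorial_mul_ascFactorial,
    Nat.ascFactorial_eq_prod_range]
  push_cast
  ring

end unitFactorial

variable {p M : ℕ} [hp : Fact p.Prime]

theorem muUpTo_le (t n : ℕ) : muUpTo p M t n ≤ t := by
  calc muUpTo p M t n ≤ #(Icc 1 t) := card_le_card fun l hl => by
        rw [mem_filter] at hl
        exact mem_Icc.2 ⟨(mem_levels.1 hl.1).1, hl.2⟩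
    _ = t := by simp

/-- The quotient `(c (w + m p ^ (s + 1)))! (c j)! / ((c w)! (c (j + m p ^ s))!)`, for
`w = a + p j`, is congruent to a `c`-th power. -/
theorem exists_factorial_quot {c a j m s : ℕ} (hc : c ≤ M) (ha : a < p)
    (hs : muUpTo p M (s + 1) (a + p * j) ≤ s) :
    ∃ σ : ℚ, σ - 1 ∈ pIdeal p (s + 1 - muUpTo p M (s + 1) (a + p * j)) ∧
      ((c * (a + p * j + m * p ^ (s + 1))).factorial : ℚ) * (c * j).factorial =
      ((unitFactorial p (p ^ (s + 1)) : ℚ) ^ m * p ^ (m * p ^ s)) ^ c * σ *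
        ((c * (a + p * j)).factorial * (c * (j + m * p ^ s)).factorial) := by
  set w := a + p * j with hw
  set μ := muUpTo p M (s + 1) w with hμ
  have hc1 : (1 : ℤ) ≤ s + 1 - μ := by omega
  have hu (n : ℕ) : (unitFactorial p n : ℚ) ≠ 0 := fun h => by
    have h' : unitFactorial p n = 0 := by exact_mod_cast h
    exact not_dvd_unitFactorial (p := p) n (h' ▸ dvd_zero p)
  have huv (n : ℕ) : padicValRat p (unitFactorial p n : ℚ) = 0 := by
    rw [padicValRat.of_nat, padicValNat.eq_zero_of_not_dvd (not_dvd_unitFactorial n)]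
    rfl
  have hp0 : (p : ℚ) ≠ 0 := by exact_mod_cast hp.out.ne_zero
  set q := p ^ (s + 1) with hq
  set σ₁ : ℚ := unitFactorial p (c * w + c * m * q) /
    (unitFactorial p (c * w) * unitFactorial p q ^ (c * m)) with hσ₁
  set σ₂ : ℚ := ∏ ε ∈ range (c * a / p),
    (((c * (j + m * p ^ s) + 1 + ε : ℕ) : ℚ) / ((c * j + 1 + ε : ℕ) : ℚ)) with hσ₂
  refine ⟨σ₁ * σ₂, mul_sub_one_mem hc1 ?_ ?_, ?_⟩
  · have hd : (unitFactorial p (c * w) * unitFactorial p q ^ (c * m) : ℚ) ≠ 0 :=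
      mul_ne_zero (hu _) (pow_ne_zero _ (hu _))
    have h1 : σ₁ - 1 = (((unitFactorial p (c * w + c * m * q) : ℤ) -
        (unitFactorial p (c * w) * unitFactorial p q ^ (c * m) : ℤ) : ℤ) : ℚ) /
        (unitFactorial p (c * w) * unitFactorial p q ^ (c * m)) := by
      rw [hσ₁]
      push_cast
      rw [sub_div, div_self hd]
    rw [h1]
    have h2 := (Nat.modEq_iff_dvd.1 (unitFactorial_add_mul_modEq (p := p) (q := q)
      (dvd_pow_self p (Nat.succ_ne_zero s)) (c * w) (c * m)).symm)
    rw [hq] at h2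
    push_cast at h2
    have h3 := div_mem_pIdeal (s := 0) (intCast_mem_pIdeal_of_dvd (p := p) h2)
      (y := (unitFactorial p (c * w) * unitFactorial p q ^ (c * m) : ℚ))
      (by rw [padicValRat.mul (hu _) (pow_ne_zero _ (hu _)), padicValRat.pow,
        huv, huv]; simp)
    refine pIdeal_mono ?_ h3
    push_cast
    omega
  · refine prod_sub_one_mem hc1 fun ε hε => ?_
    have hn0 : ((c * j + 1 + ε : ℕ) : ℚ) ≠ 0 := by positivity
    -- The factor is 1 + c m p^s / (cj + 1 + ε), so only the valuation r of its denominator matters.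
    have h1 : (((c * (j + m * p ^ s) + 1 + ε : ℕ) : ℚ) / ((c * j + 1 + ε : ℕ) : ℚ)) - 1 =
        ((c * m : ℕ) : ℚ) * (p : ℚ) ^ s * ((c * j + 1 + ε : ℕ) : ℚ)⁻¹ := by
      field_simp
      push_cast
      ring
    rw [h1]
    have hε1 : ε + 1 ≤ c * a / p := mem_range.1 hε
    set r := padicValNat p (c * j + 1 + ε) with hr
    have hdvd : p ^ r ∣ c * j + (ε + 1) := by
      rw [show c * j + (ε + 1) = c * j + 1 + ε by ring]
      exact pow_padicValNat_dvd
    -- If p^s divided the denominator, all the levels 1, …, s+1 would occur, against `hs`.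
    have hrs : r < s := by
      by_contra! h
      have := muUpTo_of_dvd hc ha (by omega) hε1 ((pow_dvd_pow p h).trans hdvd) (le_refl (s + 1))
      rw [← hw, ← hμ] at this
      omega
    have hrμ : r + 1 ≤ μ := muUpTo_of_dvd hc ha (by omega) hε1 hdvd (by omega)
    refine mul_mem_pIdeal_of_eq (r := s) (s := -r) (mul_mem_pIdeal_zero (natCast_mem_pIdeal _)
      (prime_pow_mem_pIdeal s)) (natCast_inv_mem_pIdeal le_rfl) (by omega)
  · have e1 : w + m * q = a + p * (j + m * p ^ s) := by rw [hw, hq]; ring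
    have e2 : c * w + c * m * q = c * (a + p * (j + m * p ^ s)) := by rw [← e1]; ring
    rw [e1, factorial_mul_add c (j + m * p ^ s) a, hw, factorial_mul_add c j a, hσ₁, hσ₂,
      prod_div_distrib, e2, ← hw]
    have hd : ∏ ε ∈ range (c * a / p), ((c * j + 1 + ε : ℕ) : ℚ) ≠ 0 :=
      prod_ne_zero_iff.2 fun ε _ => by positivity
    have hu1 := hu (c * w)
    have hu2 := hu q
    generalize ∏ ε ∈ range (c * a / p), ((c * j + 1 + ε : ℕ) : ℚ) = A at *
    generalize ∏ ε ∈ range (c * a / p), ((c * (j + m * p ^ s) + 1 + ε : ℕ) : ℚ) = B at *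
    generalize (unitFactorial p (c * w) : ℚ) = U at *
    generalize (unitFactorial p q : ℚ) = V at *
    rw [mul_pow (V ^ m), ← pow_mul V, mul_comm m c, pow_add (p : ℚ), mul_pow ((p : ℚ) ^ j)]
    field_simp

variable {q₁ q₂ : ℕ} {e : Fin q₁ → ℕ} {f : Fin q₂ → ℕ}

theorem Admissible.factRatio_quot_sub_one_mem (h : Admissible e f M) {a j m s : ℕ} (ha : a < p)
    (hs : muUpTo p M (s + 1) (a + p * j) ≤ s) :
    factRatio e f (a + p * j + m * p ^ (s + 1)) * factRatio e f j /
      (factRatio e f (a + p * j) * factRatio e f (j + m * p ^ s)) - 1 ∈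
      pIdeal p (s + 1 - muUpTo p M (s + 1) (a + p * j)) := by
  have hc1 : (1 : ℤ) ≤ s + 1 - muUpTo p M (s + 1) (a + p * j) := by omega
  choose σ hσ hσ' using fun i => exists_factorial_quot (m := m) (h.left_le i) ha hs
  choose τ hτ hτ' using fun i => exists_factorial_quot (m := m) (h.right_le i) ha hs
  have h0 (k : ℕ) : (k.factorial : ℚ) ≠ 0 := by exact_mod_cast Nat.factorial_ne_zero _
  have hP {n : ℕ} (g : Fin n → ℕ) (k : ℕ) : ∏ i, ((g i * k).factorial : ℚ) ≠ 0 :=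
    prod_ne_zero_iff.2 fun i _ => h0 _
  have key : factRatio e f (a + p * j + m * p ^ (s + 1)) * factRatio e f j /
      (factRatio e f (a + p * j) * factRatio e f (j + m * p ^ s)) =
      (∏ i, σ i) * (∏ i, τ i)⁻¹ := by
    have hκ : (unitFactorial p (p ^ (s + 1)) : ℚ) ^ m * p ^ (m * p ^ s) ≠ 0 := by
      refine mul_ne_zero (pow_ne_zero _ fun h => ?_)
        (pow_ne_zero _ (by exact_mod_cast hp.out.ne_zero))
      have h' : unitFactorial p (p ^ (s + 1)) = 0 := by exact_mod_cast h
      exact not_dvd_unitFactorial (p := p) (p ^ (s + 1)) (h' ▸ dvd_zero p)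
    have hτ0 : ∏ i, τ i ≠ 0 := (padicValRat_eq_zero_of_sub_one_mem hc1
      (prod_sub_one_mem hc1 fun i _ => hτ i)).1
    have h1 := prod_congr (rfl : (univ : Finset (Fin q₁)) = univ) fun i _ => hσ' i
    have h2 := prod_congr (rfl : (univ : Finset (Fin q₂)) = univ) fun i _ => hτ' i
    simp only [prod_mul_distrib, prod_pow_eq_pow_sum] at h1 h2
    -- The factor with exponent c does not otherwise depend on c, so it cancels because ∑ e_i = ∑
    -- f_j.
    rw [h.sum_eq] at h1
    have hκ' := pow_ne_zero (∑ i, f i) hκ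
    generalize ((unitFactorial p (p ^ (s + 1)) : ℚ) ^ m * p ^ (m * p ^ s)) ^ (∑ i, f i) = κ at *
    simp only [factRatio]
    have e1 := hP e j
    have e2 := hP e (a + p * j)
    have e3 := hP e (j + m * p ^ s)
    have f1 := hP f j
    have f2 := hP f (a + p * j)
    have f3 := hP f (j + m * p ^ s)
    have f4 := hP f (a + p * j + m * p ^ (s + 1))
    have h3 := eq_div_of_mul_eq e1 h1
    have h4 := eq_div_of_mul_eq f1 h2
    rw [h3, h4]
    field_simp
  rw [key]
  exact mul_sub_one_mem hc1 (prod_sub_one_mem hc1 fun i _ => hσ i)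
    (inv_sub_one_mem hc1 (prod_sub_one_mem hc1 fun i _ => hτ i))

/-- If some level ≤ s+1 is missing, the quotient of the two terms is close to 1 and the levels of a
+ pj make up the loss of precision. If none is missing, both terms separately have the required
divisibility. -/
theorem Admissible.factRatio_sub_mem (h : Admissible e f M) {a j m s : ℕ} (ha : a < p)
    (hj : M * j < p ^ s) :
    factRatio e f (a + p * j + m * p ^ (s + 1)) -
      factRatio e f (j + m * p ^ s) / factRatio e f j * factRatio e f (a + p * j) ∈
      pIdeal p (s + 1 + mu p M m) := by
  have hjs : j < p ^ s := (Nat.le_mul_of_pos_left j h.pos).trans_lt hj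
  have hw : a + p * j < p ^ (s + 1) := by
    calc a + p * j < p * (j + 1) := by rw [mul_add, mul_one]; omega
      _ ≤ p * p ^ s := Nat.mul_le_mul_left _ hjs
      _ = _ := by ring
  have hA₂ : factRatio e f (j + m * p ^ s) / factRatio e f j * factRatio e f (a + p * j) ∈
      pIdeal p (mu p M m + muUpTo p M (s + 1) (a + p * j)) :=
    mul_mem_pIdeal (h.factRatio_add_div_mem hj)
      (pIdeal_mono (by exact_mod_cast muUpTo_le_mu _ _) (h.factRatio_mem _))
  by_cases hs : muUpTo p M (s + 1) (a + p * j) ≤ s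
  · have h1 := mul_mem_pIdeal hA₂ (h.factRatio_quot_sub_one_mem (m := m) ha hs)
    refine pIdeal_mono (by omega) (Set.mem_of_eq_of_mem ?_ h1)
    have := factRatio_ne_zero e f
    have h1 := this j
    have h2 := this (a + p * j)
    have h3 := this (j + m * p ^ s)
    field_simp
  · have h2 := muUpTo_add_mu_le (M := M) (m := m) hw
    refine sub_mem (pIdeal_mono ?_ (h.factRatio_mem _)) (pIdeal_mono ?_ hA₂) <;> omega

/-- Controls the change of the weights Q(j + m p^s)/Q(j) when a digit is appended to j; the loss
μ(a+pj) will be absorbed by the block sum that the weight multiplies. -/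
theorem Admissible.factRatio_div_sub_div_mem (h : Admissible e f M) {a j m s : ℕ} (ha : a < p)
    (hw : M * (a + p * j) < p ^ (s + 1)) :
    factRatio e f (a + p * j + m * p ^ (s + 1)) / factRatio e f (a + p * j) -
      factRatio e f (j + m * p ^ s) / factRatio e f j ∈
      pIdeal p (s + 1 + mu p M m - mu p M (a + p * j)) := by
  have hj : M * j < p ^ s := by
    refine lt_of_mul_lt_mul_left (a := p) ?_ (Nat.zero_le _)
    calc p * (M * j) ≤ M * (a + p * j) := by nlinarith
      _ < p ^ (s + 1) := hw
      _ = p * p ^ s := by ring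
  have h1 : muUpTo p M s (a + p * j) = mu p M (a + p * j) := muUpTo_eq_mu hw
  have h2 : muUpTo p M s (a + p * j) ≤ s := muUpTo_le _ _
  have h3 : muUpTo p M (s + 1) (a + p * j) ≤ mu p M (a + p * j) := muUpTo_le_mu _ _
  have h4 := mul_mem_pIdeal (h.factRatio_add_div_mem (m := m) hj)
    (h.factRatio_quot_sub_one_mem (m := m) (j := j) (s := s) ha (by omega))
  refine pIdeal_mono (by omega) (Set.mem_of_eq_of_mem ?_ h4)
  have := factRatio_ne_zero e f
  have h1 := this j
  have h2 := this (a + p * j)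
  have h3 := this (j + m * p ^ s)
  field_simp

end Factorials

/-! ### Dwork's congruences for sums over p-adic blocks. -/

section Congruences

open Finset

theorem sum_range_mul_eq {A : Type*} [AddCommMonoid A] (g : ℕ → A) (a b : ℕ) :
    ∑ k ∈ range (a * b), g k = ∑ j ∈ range b, ∑ i ∈ range a, g (i + a * j) := by
  induction b with
  | zero => simp
  | succ b ih =>
    rw [mul_add_one, sum_range_add, ih, sum_range_succ]
    simp only [add_comm]

variable {q₁ q₂ : ℕ}

/-- The antisymmetric term `Q(a + p j) Q(K - j) - Q(j) Q(a + p (K - j))`, which is `0` for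
`j > K`. -/
def dworkTerm (e : Fin q₁ → ℕ) (f : Fin q₂ → ℕ) (p a K j : ℕ) : ℚ :=
  if j ≤ K then factRatio e f (a + p * j) * factRatio e f (K - j) -
    factRatio e f j * factRatio e f (a + p * (K - j)) else 0

/-- The sum of the terms `dworkTerm` over the interval `[m p ^ s, (m + 1) p ^ s)`. -/
def dworkSum (e : Fin q₁ → ℕ) (f : Fin q₂ → ℕ) (p a K s m : ℕ) : ℚ :=
  ∑ j ∈ range (p ^ s), dworkTerm e f p a K (j + m * p ^ s)

theorem dworkSum_succ (e : Fin q₁ → ℕ) (f : Fin q₂ → ℕ) (p a K s m : ℕ) :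
    dworkSum e f p a K (s + 1) m = ∑ i ∈ range p, dworkSum e f p a K s (i + p * m) := by
  simp only [dworkSum]
  rw [pow_succ, sum_range_mul_eq]
  refine sum_congr rfl fun i _ => sum_congr rfl fun j _ => ?_
  congr 1
  ring

theorem dworkSum_zero (e : Fin q₁ → ℕ) (f : Fin q₂ → ℕ) (p a K m : ℕ) :
    dworkSum e f p a K 0 m = dworkTerm e f p a K m := by
  simp [dworkSum]

theorem sum_dworkTerm (e : Fin q₁ → ℕ) (f : Fin q₂ → ℕ) (p a K : ℕ) {N : ℕ} (hN : K < N) :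
    ∑ j ∈ range N, dworkTerm e f p a K j = 0 := by
  have h1 : ∑ j ∈ range N, dworkTerm e f p a K j =
      ∑ j ∈ range (K + 1), (factRatio e f (a + p * j) * factRatio e f (K - j) -
        factRatio e f j * factRatio e f (a + p * (K - j))) := by
    simp only [dworkTerm]
    rw [← sum_filter]
    refine sum_congr ?_ fun _ _ => rfl
    ext j
    simp only [mem_filter, mem_range]
    omega
  rw [h1, sum_sub_distrib, sub_eq_zero, ← sum_range_reflect]
  refine sum_congr rfl fun j hj => ?_
  have := mem_range.1 hj
  rw [show K + 1 - 1 - j = K - j by omega, show K - (K - j) = j by omega, mul_comm]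

theorem dworkSum_eq_zero (e : Fin q₁ → ℕ) (f : Fin q₂ → ℕ) (p a : ℕ) {K s m : ℕ}
    (h : K < m * p ^ s) : dworkSum e f p a K s m = 0 :=
  sum_eq_zero fun j _ => if_neg (by omega)

/-- The sum of `c j * dworkSum t (j + b * p ^ x)` over the `j < p ^ x` with `M * j < p ^ x`. -/
def restrictedSum (e : Fin q₁ → ℕ) (f : Fin q₂ → ℕ) (p M a K : ℕ) (c : ℕ → ℚ) (t x b : ℕ) : ℚ :=
  ∑ j ∈ range (p ^ x), if M * j < p ^ x then c j * dworkSum e f p a K t (j + b * p ^ x) else 0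

theorem restrictedSum_zero (e : Fin q₁ → ℕ) (f : Fin q₂ → ℕ) (p M a K t b : ℕ) (c : ℕ → ℚ) :
    restrictedSum e f p M a K c t 0 b = c 0 * dworkSum e f p a K t b := by
  simp [restrictedSum]

section congruence

variable {e : Fin q₁ → ℕ} {f : Fin q₂ → ℕ} {p M : ℕ} [hp : Fact p.Prime]

/-- Passing from `x` to `x + 1` in a restricted sum. -/
theorem restrictedSum_sub_mem {a K x t b : ℕ} {c c' : ℕ → ℚ} {r : ℤ}
    (h₁ : ∀ i j, i < p → M * j < p ^ x → p ^ (x + 1) ≤ M * (i + p * j) →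
      c j * dworkSum e f p a K t (i + p * j + b * p ^ (x + 1)) ∈ pIdeal p r)
    (h₂ : ∀ i j, i < p → M * (i + p * j) < p ^ (x + 1) →
      (c j - c' (i + p * j)) * dworkSum e f p a K t (i + p * j + b * p ^ (x + 1)) ∈ pIdeal p r) :
    restrictedSum e f p M a K c (t + 1) x b - restrictedSum e f p M a K c' t (x + 1) b ∈
      pIdeal p r := by
  have hlt {i j : ℕ} (h : M * (i + p * j) < p ^ (x + 1)) : M * j < p ^ x := by
    refine lt_of_mul_lt_mul_left (a := p) ?_ (Nat.zero_le _)
    calc p * (M * j) ≤ M * (i + p * j) := by nlinarith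
      _ < p ^ (x + 1) := h
      _ = p * p ^ x := by ring
  simp only [restrictedSum]
  rw [pow_succ', sum_range_mul_eq, ← sum_sub_distrib]
  refine sum_mem fun j _ => ?_
  rw [← pow_succ']
  by_cases hj : M * j < p ^ x
  · rw [if_pos hj, dworkSum_succ, mul_sum, ← sum_sub_distrib]
    refine sum_mem fun i hi => ?_
    have hip := mem_range.1 hi
    rw [show i + p * (j + b * p ^ x) = i + p * j + b * p ^ (x + 1) by ring]
    split_ifs with hij
    · rw [← sub_mul]
      exact h₂ i j hip hij
    · rw [sub_zero]
      exact h₁ i j hip hj (not_lt.1 hij)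
  · rw [if_neg hj, zero_sub]
    refine neg_mem (sum_mem fun i _ => ?_)
    rw [if_neg fun h => hj (hlt h)]
    exact zero_mem _

variable {a s : ℕ}

/-- Refine the block one digit at a time, discarding a subblock once M j reaches p^x: by
`muUpTo_add_digit` it then has all its levels, and the induction hypothesis makes its sum
negligible. -/
theorem Admissible.dworkSum_sub_restrictedSum_mem (h : Admissible e f M)
    (ih : ∀ t < s, ∀ K m, dworkSum e f p a K t m ∈ pIdeal p (t + 1 + mu p M m))
    (K m : ℕ) {x t : ℕ} (hx : x + t = s) :
    dworkSum e f p a K s m - restrictedSum e f p M a K 1 t x m ∈ pIdeal p (s + 1 + mu p M m) := by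
  induction x generalizing t with
  | zero =>
    obtain rfl : t = s := by omega
    rw [restrictedSum_zero, Pi.one_apply, one_mul, sub_self]
    exact zero_mem _
  | succ x ihx =>
    rw [← sub_add_sub_cancel _ (restrictedSum e f p M a K 1 (t + 1) x m)]
    refine add_mem (ihx (by omega)) (restrictedSum_sub_mem (fun i j hi hj hij => ?_)
      fun i j _ _ => ?_)
    · rw [Pi.one_apply, one_mul]
      refine pIdeal_mono ?_ (ih t (by omega) _ _)
      have h1 := muUpTo_add_digit hj hij hi
      have hlt : i + p * j < p ^ (x + 1) := by
        have hjx : j < p ^ x := (Nat.le_mul_of_pos_left j h.pos).trans_lt hj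
        calc i + p * j < p * (j + 1) := by rw [mul_add, mul_one]; omega
          _ ≤ p * p ^ x := Nat.mul_le_mul_left _ hjx
          _ = _ := by ring
      have h2 := muUpTo_add_mu_le (M := M) (m := m) hlt
      omega
    · simp [zero_mem]

/-- The same refinement starting from Q(m) times the block 0. The weight Q(m) is replaced
progressively by Q(j + m p^x)/Q(j), each change being negligible against the block sum. -/
theorem Admissible.restrictedSum_sub_dworkSum_mem (h : Admissible e f M)
    (ih : ∀ t < s, ∀ K m, dworkSum e f p a K t m ∈ pIdeal p (t + 1 + mu p M m))
    (K m : ℕ) {x t : ℕ}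
    (hx : x + t = s) :
    factRatio e f m * dworkSum e f p a K s 0 - restrictedSum e f p M a K
      (fun j => factRatio e f (j + m * p ^ x) / factRatio e f j) t x 0 ∈
      pIdeal p (s + 1 + mu p M m) := by
  induction x generalizing t with
  | zero =>
    obtain rfl : t = s := by omega
    rw [restrictedSum_zero]
    simp [factRatio_zero, zero_mem]
  | succ x ihx =>
    rw [← sub_add_sub_cancel _ (restrictedSum e f p M a K
      (fun j => factRatio e f (j + m * p ^ x) / factRatio e f j) (t + 1) x 0)]
    refine add_mem (ihx (by omega)) (restrictedSum_sub_mem (fun i j hi hj hij => ?_)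
      fun i j hi hij => ?_)
    · rw [zero_mul, add_zero]
      have h1 := muUpTo_add_digit hj hij hi
      have h2 := muUpTo_le_mu (p := p) (M := M) (x + 1) (i + p * j)
      exact mul_mem_pIdeal_of_eq (h.factRatio_add_div_mem hj) (ih t (by omega) _ _) (by omega)
    · rw [zero_mul, add_zero]
      rw [← neg_sub, neg_mul]
      exact neg_mem (mul_mem_pIdeal_of_eq (h.factRatio_div_sub_div_mem hi hij)
        (ih t (by omega) _ _) (by omega))

/-- At full refinement the comparison is termwise. Shifting both K and j by m p^s fixes K - j, so
the second halves of the two antisymmetric terms cancel and `Admissible.factRatio_sub_mem` handles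
the first. -/
theorem Admissible.restrictedSum_sub_restrictedSum_mem (h : Admissible e f M) (K m : ℕ) (ha : a < p) :
    restrictedSum e f p M a (K + m * p ^ s) 1 0 s m - restrictedSum e f p M a K
      (fun j => factRatio e f (j + m * p ^ s) / factRatio e f j) 0 s 0 ∈
      pIdeal p (s + 1 + mu p M m) := by
  simp only [restrictedSum, ← sum_sub_distrib]
  refine sum_mem fun j _ => ?_
  split_ifs with hj
  swap
  · simp [zero_mem]
  rw [dworkSum_zero, dworkSum_zero, zero_mul, add_zero]
  simp only [Pi.one_apply, one_mul, dworkTerm]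
  simp only [show j + m * p ^ s ≤ K + m * p ^ s ↔ j ≤ K by omega,
    show K + m * p ^ s - (j + m * p ^ s) = K - j by omega,
    show a + p * (j + m * p ^ s) = a + p * j + m * p ^ (s + 1) by ring]
  split_ifs with hjK
  · have key := mul_mem_pIdeal (h.factRatio_sub_mem (m := m) ha hj) (h.factRatio_mem_zero (K - j))
    rw [add_zero] at key
    refine Set.mem_of_eq_of_mem ?_ key
    have := factRatio_ne_zero e f j
    field_simp
    ring
  · simp [zero_mem]

theorem Admissible.dworkSum_add_sub_mem (h : Admissible e f M)
    (ih : ∀ t < s, ∀ K m, dworkSum e f p a K t m ∈ pIdeal p (t + 1 + mu p M m))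
    (ha : a < p) (K m : ℕ) :
    dworkSum e f p a (K + m * p ^ s) s m - factRatio e f m * dworkSum e f p a K s 0 ∈
      pIdeal p (s + 1 + mu p M m) := by
  have h1 := h.dworkSum_sub_restrictedSum_mem ih (K + m * p ^ s) m (add_zero s)
  have h2 := h.restrictedSum_sub_restrictedSum_mem (p := p) (a := a) (s := s) K m ha
  have h3 := h.restrictedSum_sub_dworkSum_mem ih K m (add_zero s)
  refine Set.mem_of_eq_of_mem ?_ (sub_mem (add_mem h1 h2) h3)
  ring

end congruence

theorem Admissible.dworkSum_mem {e : Fin q₁ → ℕ} {f : Fin q₂ → ℕ} {p M : ℕ} [hp : Fact p.Prime]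
    (h : Admissible e f M) {a : ℕ} (ha : a < p) (s K m : ℕ) :
    dworkSum e f p a K s m ∈ pIdeal p (s + 1 + mu p M m) := by
  induction s using Nat.strong_induction_on generalizing K m with
  | _ s ih =>
  have hps : 0 < p ^ s := pow_pos hp.out.pos s
  have step (K m : ℕ) := h.dworkSum_add_sub_mem ih ha K m
  -- The sum of all blocks vanishes by antisymmetry, so block 0 is minus the sum of the others; each
  -- of these reduces to block 0 for the smaller K - m p^s.
  have zero (K : ℕ) : dworkSum e f p a K s 0 ∈ pIdeal p (s + 1) := by
    induction K using Nat.strong_induction_on with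
    | _ K ihK =>
    have h1 : ∑ m ∈ range (K + 1), dworkSum e f p a K s m = 0 := by
      rw [← sum_dworkTerm e f p a K (N := p ^ s * (K + 1)) (by nlinarith), sum_range_mul_eq]
      refine sum_congr rfl fun m _ => sum_congr rfl fun j _ => ?_
      rw [mul_comm m]
    rw [sum_range_succ', ← eq_neg_iff_add_eq_zero.trans Iff.rfl] at h1
    rw [← neg_neg (dworkSum e f p a K s 0), ← h1]
    refine neg_mem (sum_mem fun m _ => ?_)
    by_cases hm : (m + 1) * p ^ s ≤ K
    · obtain ⟨K', rfl⟩ := Nat.exists_eq_add_of_le' hm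
      have h2 := pIdeal_mono (s := s + 1) (by omega) (step K' (m + 1))
      have h3 := mul_mem_pIdeal_zero (h.factRatio_mem_zero (m + 1)) (ihK K' (by nlinarith))
      simpa using add_mem h2 h3
    · rw [dworkSum_eq_zero _ _ _ _ (not_le.1 hm)]
      exact zero_mem _
  by_cases hm : m * p ^ s ≤ K
  · obtain ⟨K', rfl⟩ := Nat.exists_eq_add_of_le' hm
    have h3 := mul_mem_pIdeal_of_eq (t := s + 1 + mu p M m) (h.factRatio_mem m) (zero K')
      (by omega)
    simpa using add_mem (step K' m) h3
  · rw [dworkSum_eq_zero _ _ _ _ (not_le.1 hm)]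
    exact zero_mem _

end Congruences

/-! ### Harmonic numbers and summation by parts. -/

section HarmonicNumbers

open Finset

/-- The sum of the inverses of the positive integers up to `n` which are not divisible by `p`. -/
def unitHarmonic (p n : ℕ) : ℚ := ∑ k ∈ range n, if p ∣ k + 1 then 0 else ((k + 1 : ℕ) : ℚ)⁻¹

theorem harmonic_eq_unitHarmonic_add (p n : ℕ) :
    harmonic n = unitHarmonic p n + (p : ℚ)⁻¹ * harmonic (n / p) := by
  induction n with
  | zero => simp [unitHarmonic]
  | succ n ih =>
    rw [harmonic_succ, ih, unitHarmonic, unitHarmonic, sum_range_succ, Nat.succ_div]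
    split_ifs with h
    · have h1 : n + 1 = p * (n / p + 1) := by
        have := Nat.succ_div_of_dvd h
        rw [← Nat.succ_eq_add_one (n / p), Nat.succ_eq_add_one, ← this, Nat.mul_div_cancel' h]
      rw [harmonic_succ, mul_add, ← mul_inv, ← Nat.cast_mul, ← h1]
      ring
    · rw [add_zero]
      ring

theorem harmonic_add_sub (n k : ℕ) :
    harmonic (n + k) - harmonic n = ∑ ε ∈ range k, ((n + (ε + 1) : ℕ) : ℚ)⁻¹ := by
  rw [harmonic, harmonic, sum_range_add, add_sub_cancel_left]
  rfl

variable {p M : ℕ} [hp : Fact p.Prime]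

theorem unitHarmonic_mem (n : ℕ) : unitHarmonic p n ∈ pIdeal p 0 := by
  refine sum_mem fun k _ => ?_
  split_ifs with h
  · exact zero_mem _
  · exact natCast_inv_mem_pIdeal_zero h

theorem prime_mul_harmonic (c a j : ℕ) :
    (p : ℚ) * harmonic (c * (a + p * j)) =
      p * unitHarmonic p (c * (a + p * j)) + harmonic (c * j + c * a / p) := by
  have hp0 : (p : ℚ) ≠ 0 := by exact_mod_cast hp.out.ne_zero
  rw [harmonic_eq_unitHarmonic_add p (c * (a + p * j)),
    show c * (a + p * j) = c * a + p * (c * j) by ring, Nat.add_mul_div_left _ _ hp.out.pos,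
    add_comm (c * a / p)]
  field_simp

theorem harmonic_add_sub_mem {L a j t : ℕ} (hL : p ^ t * L ≤ M) (ha : a < p) :
    harmonic (L * j + L * a / p) - harmonic (L * j) ∈ pIdeal p (t + 1 - mu p M (a + p * j)) := by
  rw [harmonic_add_sub]
  refine sum_mem fun ε hε => ?_
  have h1 := mu_of_dvd hL ha (by omega) (mem_range.1 hε)
    (pow_padicValNat_dvd (p := p) (n := L * j + (ε + 1)))
  refine pIdeal_mono ?_ (natCast_inv_mem_pIdeal le_rfl)
  omega

/-- A nonzero n has at least t levels, so the exponent t - μ(n) is not positive and p-integral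
errors are harmless. -/
theorem mem_pIdeal_sub_mu {L t n : ℕ} {x : ℚ} (hL0 : 0 < L) (hL : p ^ t * L ≤ M) (hn : n ≠ 0)
    (hx : x ∈ pIdeal p 0) : x ∈ pIdeal p (t - mu p M n) := by
  have := le_mu_of_pow_le ((Nat.le_mul_of_pos_right (p ^ t) hL0).trans hL) hn
  exact pIdeal_mono (by omega) hx

theorem harmonic_sub_harmonic_mem {L a j t : ℕ} (hL0 : 0 < L) (hL : p ^ t * L ≤ M) (ha : a < p) :
    harmonic (L * (a + p * j)) - harmonic (L * (p * j)) ∈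
      pIdeal p (t - mu p M (a + p * j)) := by
  have hp0 : (p : ℚ) ≠ 0 := by exact_mod_cast hp.out.ne_zero
  by_cases h0 : a + p * j = 0
  · have : a = 0 := by omega
    simp [this, zero_mem]
  have h1 := prime_mul_harmonic (p := p) L a j
  have h2 := prime_mul_harmonic (p := p) L 0 j
  simp only [zero_add, mul_zero, Nat.zero_div, add_zero] at h2
  have h3 : harmonic (L * (a + p * j)) - harmonic (L * (p * j)) =
      (unitHarmonic p (L * (a + p * j)) - unitHarmonic p (L * (p * j))) +
        (p : ℚ)⁻¹ * (harmonic (L * j + L * a / p) - harmonic (L * j)) := by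
    apply mul_left_cancel₀ hp0
    rw [mul_sub, h1, h2]
    field_simp
    ring
  rw [h3]
  exact add_mem (mem_pIdeal_sub_mu hL0 hL h0
    (sub_mem (unitHarmonic_mem _) (unitHarmonic_mem _)))
    (mul_mem_pIdeal_of_eq prime_inv_mem_pIdeal (harmonic_add_sub_mem hL ha) (by omega))

theorem pow_mul_harmonic_sub_mem (s x : ℕ) :
    (p : ℚ) ^ s * harmonic (x * p ^ s) - harmonic x ∈ pIdeal p 0 := by
  induction s with
  | zero => simp [zero_mem]
  | succ s ih =>
    have h1 := prime_mul_harmonic (p := p) 1 0 (x * p ^ s)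
    simp only [zero_add, mul_zero, Nat.zero_div, add_zero, one_mul] at h1
    have h2 : (p : ℚ) ^ (s + 1) * harmonic (x * p ^ (s + 1)) - harmonic x =
        (p : ℚ) ^ (s + 1) * unitHarmonic p (p * (x * p ^ s)) +
          ((p : ℚ) ^ s * harmonic (x * p ^ s) - harmonic x) := by
      rw [show x * p ^ (s + 1) = p * (x * p ^ s) by ring, pow_succ, mul_assoc, h1]
      ring
    rw [h2]
    refine add_mem (mul_mem_pIdeal_zero ?_ (unitHarmonic_mem _)) ih
    exact_mod_cast natCast_mem_pIdeal (p ^ (s + 1))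

/-- Modulo p-integers, p^s H_{x p^s} is H_x; this is the case s = 0 divided by p^s. -/
theorem harmonic_pow_sub_harmonic_pow_mem {L a j t : ℕ} (s : ℕ) (hL0 : 0 < L)
    (hL : p ^ t * L ≤ M) (ha : a < p) :
    harmonic (L * ((a + p * j) * p ^ s)) - harmonic (L * (j * p ^ (s + 1))) ∈
      pIdeal p (t - s - mu p M (a + p * j)) := by
  have hp0 : (p : ℚ) ≠ 0 := by exact_mod_cast hp.out.ne_zero
  by_cases h0 : a + p * j = 0
  · obtain rfl : a = 0 := by omega
    rw [show L * ((0 + p * j) * p ^ s) = L * (j * p ^ (s + 1)) by ring, sub_self]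
    exact zero_mem _
  have h1 := pow_mul_harmonic_sub_mem (p := p) s (L * (a + p * j))
  have h2 := pow_mul_harmonic_sub_mem (p := p) s (L * (p * j))
  have h3 := add_mem (mem_pIdeal_sub_mu hL0 hL h0 (sub_mem h1 h2))
    (harmonic_sub_harmonic_mem (j := j) hL0 hL ha)
  have h4 := mul_mem_pIdeal (prime_zpow_mem_pIdeal (p := p) (-s)) h3
  refine pIdeal_mono (r := -s + (t - mu p M (a + p * j))) (by omega) (Set.mem_of_eq_of_mem ?_ h4)
  rw [zpow_neg, zpow_natCast, show L * (a + p * j) * p ^ s = L * ((a + p * j) * p ^ s) by ring,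
    show L * (p * j) * p ^ s = L * (j * p ^ (s + 1)) by ring]
  field_simp
  ring

variable {q₁ q₂ : ℕ} {e : Fin q₁ → ℕ} {f : Fin q₂ → ℕ}

/-- Summation by parts: split the block into p subblocks and move the base point of H to the start
of each. The correction costs p^(s+μ-t), while the subblock sum gains p^(s+1+μ), leaving p^(t+1). -/
theorem Admissible.sum_harmonic_sub_mul_dworkTerm_mem (h : Admissible e f M) {L t a : ℕ}
    (hL0 : 0 < L) (hL : p ^ t * L ≤ M) (ha : a < p) (K s m : ℕ) :
    ∑ j ∈ range (p ^ s), (harmonic (L * (j + m * p ^ s)) - harmonic (L * (m * p ^ s))) *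
      dworkTerm e f p a K (j + m * p ^ s) ∈ pIdeal p (t + 1) := by
  induction s generalizing m with
  | zero => simp [zero_mem]
  | succ s ih =>
    rw [pow_succ, sum_range_mul_eq]
    refine sum_mem fun i hi => ?_
    have hj (j : ℕ) : j + p ^ s * i + m * (p ^ s * p) = j + (i + p * m) * p ^ s := by ring
    simp only [hj]
    have h1 (j : ℕ) : harmonic (L * (j + (i + p * m) * p ^ s)) - harmonic (L * (m * (p ^ s * p)))
        = (harmonic (L * (j + (i + p * m) * p ^ s)) - harmonic (L * ((i + p * m) * p ^ s))) +
        (harmonic (L * ((i + p * m) * p ^ s)) - harmonic (L * (m * p ^ (s + 1)))) := by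
      rw [pow_succ]
      ring
    simp only [h1, add_mul (_ - _) (_ - _), sum_add_distrib]
    rw [← mul_sum]
    exact add_mem (ih _) (mul_mem_pIdeal_of_eq
      (harmonic_pow_sub_harmonic_pow_mem s hL0 hL (mem_range.1 hi))
      (h.dworkSum_mem ha s K (i + p * m)) (by omega))

theorem Admissible.sum_harmonic_mul_dworkTerm_mem (h : Admissible e f M) {L t a : ℕ}
    (hL0 : 0 < L) (hL : p ^ t * L ≤ M) (ha : a < p) (K : ℕ) :
    ∑ j ∈ range (K + 1), harmonic (L * j) * dworkTerm e f p a K j ∈ pIdeal p (t + 1) := by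
  -- Since p^(K+1) > K, block 0 of this length contains every nonzero term.
  have h1 := h.sum_harmonic_sub_mul_dworkTerm_mem hL0 hL ha K (K + 1) 0
  simp only [zero_mul, add_zero, mul_zero, harmonic_zero, sub_zero] at h1
  rwa [← sum_subset (range_mono (Nat.lt_pow_self hp.out.one_lt).le)] at h1
  intro j _ hj
  rw [dworkTerm, if_neg (by simpa using hj), mul_zero]

theorem Admissible.sum_factRatio_mul_harmonic_mem (h : Admissible e f M) {L t a : ℕ}
    (hL0 : 0 < L) (hL : p ^ t * L ≤ M) (ha : a < p) (K : ℕ) :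
    ∑ j ∈ range (K + 1), factRatio e f (a + p * j) * factRatio e f (K - j) *
      (harmonic (L * (K - j)) - p * harmonic (L * (a + p * j))) ∈ pIdeal p (t + 1) := by
  -- Replace p H_{L(a+pj)} by H_{Lj} plus two small corrections, and reflect j ↦ K - j in the other
  -- half.
  have h1 : ∑ j ∈ range (K + 1), factRatio e f (a + p * j) * factRatio e f (K - j) *
      (harmonic (L * (K - j)) - p * harmonic (L * (a + p * j))) =
      - ∑ j ∈ range (K + 1), harmonic (L * j) * dworkTerm e f p a K j -
      ∑ j ∈ range (K + 1), factRatio e f (K - j) *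
        (factRatio e f (a + p * j) * (p * unitHarmonic p (L * (a + p * j))) +
        factRatio e f (a + p * j) * (harmonic (L * j + L * a / p) - harmonic (L * j))) := by
    have h2 : ∑ j ∈ range (K + 1),
        factRatio e f (a + p * j) * factRatio e f (K - j) * harmonic (L * (K - j)) =
        ∑ j ∈ range (K + 1),
        factRatio e f (a + p * (K - j)) * factRatio e f j * harmonic (L * j) := by
      rw [← sum_range_reflect]
      refine sum_congr rfl fun j hj => ?_
      have := mem_range.1 hj
      rw [show K + 1 - 1 - j = K - j by omega, show K - (K - j) = j by omega]
    simp only [mul_sub, sum_sub_distrib, h2]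
    rw [← sum_neg_distrib, ← sum_sub_distrib, ← sum_sub_distrib]
    refine sum_congr rfl fun j hj => ?_
    rw [dworkTerm, if_pos (Nat.lt_succ_iff.1 (mem_range.1 hj)), prime_mul_harmonic]
    ring
  rw [h1]
  refine sub_mem (neg_mem (h.sum_harmonic_mul_dworkTerm_mem hL0 hL ha K)) (sum_mem fun j _ => ?_)
  refine mul_mem_pIdeal_zero (h.factRatio_mem_zero _) (add_mem ?_ ?_)
  · by_cases h0 : a + p * j = 0
    · simp [h0, unitHarmonic, zero_mem]
    · exact mul_mem_pIdeal_of_eq (h.factRatio_mem _) (mul_mem_pIdeal prime_mem_pIdeal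
        (mem_pIdeal_sub_mu hL0 hL h0 (unitHarmonic_mem _))) (by omega)
  · exact mul_mem_pIdeal_of_eq (h.factRatio_mem _) (harmonic_add_sub_mem hL ha) (by omega)

end HarmonicNumbers

/-! ### Dwork's integrality lemma for exponentials. -/

section DworkLemma

open Finset PowerSeries

/-- The power series all of whose coefficients lie in `p ^ r ℤ₍ₚ₎`. -/
def seriesIdeal (p : ℕ) [Fact p.Prime] (r : ℤ) : AddSubgroup ℚ⟦X⟧ where
  carrier := {u | ∀ n, coeff n u ∈ pIdeal p r}
  zero_mem' := fun n => by simp [zero_mem]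
  add_mem' := fun hu hv n => by
    rw [map_add]
    exact add_mem (hu n) (hv n)
  neg_mem' := fun hu n => by
    rw [map_neg]
    exact neg_mem (hu n)

section Dwork

variable {p : ℕ} [hp : Fact p.Prime] {r s : ℤ} {u v : ℚ⟦X⟧}

theorem seriesIdeal_mono (h : s ≤ r) (hu : u ∈ seriesIdeal p r) : u ∈ seriesIdeal p s :=
  fun n => pIdeal_mono h (hu n)

theorem mul_mem_seriesIdeal (hu : u ∈ seriesIdeal p r) (hv : v ∈ seriesIdeal p s) :
    u * v ∈ seriesIdeal p (r + s) := fun n => by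
  rw [coeff_mul]
  exact sum_mem fun x _ => mul_mem_pIdeal (hu _) (hv _)

theorem mul_mem_seriesIdeal_zero (hu : u ∈ seriesIdeal p 0) (hv : v ∈ seriesIdeal p r) :
    u * v ∈ seriesIdeal p r := by
  simpa using mul_mem_seriesIdeal hu hv

theorem smul_mem_seriesIdeal {c : ℚ} (hc : c ∈ pIdeal p r) (hv : v ∈ seriesIdeal p s) :
    c • v ∈ seriesIdeal p (r + s) := fun n => by
  rw [coeff_smul, smul_eq_mul]
  exact mul_mem_pIdeal hc (hv n)

theorem one_mem_seriesIdeal : (1 : ℚ⟦X⟧) ∈ seriesIdeal p 0 := fun n => by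
  rw [coeff_one]
  split_ifs
  exacts [one_mem_pIdeal, zero_mem _]

/-- The subring of power series with `p`-integral coefficients. -/
def integralSeries (p : ℕ) [Fact p.Prime] : Subring ℚ⟦X⟧ :=
  { seriesIdeal p 0 with
    one_mem' := one_mem_seriesIdeal
    mul_mem' := mul_mem_seriesIdeal_zero }

theorem mem_integralSeries : u ∈ integralSeries p ↔ u ∈ seriesIdeal p 0 := Iff.rfl

theorem expand_mem_seriesIdeal (hu : u ∈ seriesIdeal p r) :
    expand p hp.out.ne_zero u ∈ seriesIdeal p r := fun n => by
  rw [coeff_expand]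
  split_ifs
  exacts [hu _, zero_mem _]

theorem inv_mem_seriesIdeal (hu : u ∈ seriesIdeal p 0) (h1 : constantCoeff u = 1) :
    u⁻¹ ∈ seriesIdeal p 0 := fun n => by
  induction n using Nat.strong_induction_on with
  | _ n ih =>
  rw [PowerSeries.coeff_inv, h1, inv_one]
  split_ifs
  · exact one_mem_pIdeal
  · rw [neg_one_mul]
    refine neg_mem (sum_mem fun x _ => ?_)
    split_ifs with hx
    · exact mul_mem_pIdeal_zero (hu _) (ih _ hx)
    · exact zero_mem _

theorem pow_prime_sub_self_mem {x : ℚ} (hx : x ∈ pIdeal p 0) : x ^ p - x ∈ pIdeal p 1 := by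
  have hd := not_dvd_den_of_mem hx
  have hd0 : (x.den : ℚ) ≠ 0 := by exact_mod_cast x.den_nz
  have h1 : x ^ p - x = ((x.num ^ p * x.den - x.num * x.den ^ p : ℤ) : ℚ) *
      ((x.den : ℚ)⁻¹ ^ (p + 1)) := by
    conv_lhs => rw [← Rat.num_div_den x]
    push_cast
    rw [pow_succ, div_pow, inv_pow]
    field_simp
  have h2 : ((p : ℤ) ^ 1) ∣ x.num ^ p * x.den - x.num * x.den ^ p := by
    rw [pow_one, ← ZMod.intCast_zmod_eq_zero_iff_dvd]
    push_cast
    rw [ZMod.pow_card, ZMod.pow_card, sub_self]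
  rw [h1]
  have h3 := mul_mem_pIdeal (intCast_mem_pIdeal_of_dvd h2)
    (pow_mem_pIdeal_zero (natCast_inv_mem_pIdeal_zero hd) (p + 1))
  simpa using h3

/-- The Frobenius congruence for polynomials with `p`-integral coefficients. -/
theorem expand_sub_pow_mem {c : ℕ → ℚ} (n : ℕ) (hc : ∀ i < n, c i ∈ pIdeal p 0) :
    expand p hp.out.ne_zero (∑ i ∈ range n, monomial i (c i)) -
      (∑ i ∈ range n, monomial i (c i)) ^ p ∈ seriesIdeal p 1 := by
  have hmon (i : ℕ) {x : ℚ} {r : ℤ} (hx : x ∈ pIdeal p r) : monomial i x ∈ seriesIdeal p r :=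
    fun k => by
      rw [coeff_monomial]
      split_ifs
      exacts [hx, zero_mem _]
  induction n with
  | zero => simp [zero_pow hp.out.ne_zero, zero_mem]
  | succ n ih =>
    have ih := ih fun i hi => hc i (by omega)
    rw [sum_range_succ, map_add]
    set t := ∑ i ∈ range n, monomial i (c i) with ht
    have ht0 : t ∈ integralSeries p :=
      sum_mem fun i hi => hmon i (hc i (by rw [mem_range] at hi; omega))
    have hm0 : monomial n (c n) ∈ integralSeries p := hmon n (hc n (by omega))
    obtain ⟨w, hw⟩ := exists_add_pow_prime_eq hp.out (⟨t, ht0⟩ : integralSeries p) ⟨_, hm0⟩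
    have hw' : (t + monomial n (c n)) ^ p =
        t ^ p + monomial n (c n) ^ p + p * t * monomial n (c n) * (w : ℚ⟦X⟧) := by
      have := congrArg Subtype.val hw
      simpa using this
    have h1 : expand p hp.out.ne_zero (monomial n (c n)) - monomial n (c n) ^ p ∈
        seriesIdeal p 1 := by
      rw [expand_monomial, monomial_pow, ← map_sub, ← neg_sub, map_neg]
      exact neg_mem (hmon _ (pow_prime_sub_self_mem (hc n (by omega))))
    have h2 : (p : ℚ⟦X⟧) * t * monomial n (c n) * (w : ℚ⟦X⟧) ∈ seriesIdeal p 1 := by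
      have h3 : t * monomial n (c n) * (w : ℚ⟦X⟧) ∈ seriesIdeal p 0 :=
        mul_mem_seriesIdeal_zero (mul_mem_seriesIdeal_zero ht0 hm0) w.2
      have h4 := smul_mem_seriesIdeal prime_mem_pIdeal h3
      rw [add_zero] at h4
      refine Set.mem_of_eq_of_mem ?_ h4
      rw [smul_eq_C_mul, map_natCast]
      ring
    rw [hw']
    refine Set.mem_of_eq_of_mem ?_ (sub_mem (add_mem ih h1) h2)
    ring

/-- A series `u` with constant term `1` such that `u(z ^ p) = u(z) ^ p * v(z)`, with
`v ∈ 1 + p ℤ₍ₚ₎⟦z⟧`, has `p`-integral coefficients. -/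
theorem mem_seriesIdeal_of_expand_eq (h0 : constantCoeff u = 1) (hv : v - 1 ∈ seriesIdeal p 1)
    (hv0 : constantCoeff v = 1) (h : expand p hp.out.ne_zero u = u ^ p * v) :
    u ∈ seriesIdeal p 0 := fun n => by
  induction n using Nat.strong_induction_on with
  | _ n ih =>
  rcases Nat.eq_zero_or_pos n with rfl | hn
  · rw [coeff_zero_eq_constantCoeff_apply, h0]
    exact one_mem_pIdeal
  set t := ∑ i ∈ range n, monomial i (coeff i u) with ht
  have htc (i : ℕ) (hi : i < n) : coeff i t = coeff i u := by
    rw [ht, map_sum, sum_eq_single_of_mem i (mem_range.2 hi)]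
    · simp
    · intro b _ hb
      rw [coeff_monomial, if_neg hb.symm]
  have htn : coeff n t = 0 := by
    rw [ht, map_sum]
    refine sum_eq_zero fun i hi => ?_
    rw [coeff_monomial, if_neg (by rw [mem_range] at hi; omega)]
  have ht0 : t ∈ seriesIdeal p 0 := fun k => by
    rcases lt_or_ge k n with hk | hk
    · rw [htc k hk]
      exact ih k hk
    · rw [ht, map_sum]
      refine sum_mem fun i hi => ?_
      rw [coeff_monomial, if_neg (by rw [mem_range] at hi; omega)]
      exact zero_mem _
  obtain ⟨w, hw⟩ : X ^ n ∣ u - t := by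
    rw [X_pow_dvd_iff]
    intro m hm
    rw [map_sub, htc m hm, sub_self]
  have hu : u = t + X ^ n * w := by rw [← hw]; ring
  have hwn : constantCoeff w = coeff n u := by
    have := congrArg (coeff n) hw
    rw [map_sub, htn, sub_zero, coeff_X_pow_mul', if_pos le_rfl, Nat.sub_self,
      coeff_zero_eq_constantCoeff_apply] at this
    exact this.symm
  have htcc : constantCoeff t = 1 := by
    rw [← coeff_zero_eq_constantCoeff_apply, htc 0 hn, coeff_zero_eq_constantCoeff_apply, h0]
  -- To first order, u^p = t^p + p t^(p-1) X^n w, so the n-th coefficient of u enters multiplied by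
  -- p.
  obtain ⟨k, hk⟩ := Polynomial.powAddExpansion t (X ^ n * w) p
  have h1 : expand p hp.out.ne_zero u = t ^ p * v +
      X ^ n * (((p : ℚ⟦X⟧) * t ^ (p - 1) * w + X ^ n * (k * w ^ 2)) * v) := by
    rw [h]
    conv_lhs => rw [hu, hk]
    ring
  have h2 := congrArg (coeff n) h1
  have hcc : constantCoeff (((p : ℚ⟦X⟧) * t ^ (p - 1) * w + X ^ n * (k * w ^ 2)) * v) =
      p * coeff n u := by
    simp [hv0, htcc, hwn, hn.ne']
  rw [map_add, coeff_X_pow_mul', if_pos le_rfl, Nat.sub_self, coeff_zero_eq_constantCoeff_apply,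
    hcc] at h2
  -- The n-th coefficient of u(z^p) involves only the index n/p < n, where u and its truncation
  -- agree.
  have h3 : coeff n (expand p hp.out.ne_zero u) = coeff n (expand p hp.out.ne_zero t) := by
    rw [coeff_expand, coeff_expand]
    split_ifs
    · rw [htc _ (Nat.div_lt_self hn hp.out.one_lt)]
    · rfl
  have h4 := expand_sub_pow_mem (p := p) n (c := fun i => coeff i u) ih
  have htp : t ^ p ∈ integralSeries p := pow_mem (mem_integralSeries.2 ht0) p
  have h5 := sub_mem h4 (mul_mem_seriesIdeal_zero htp hv) n
  have h6 : (p : ℚ) * coeff n u ∈ pIdeal p 1 := by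
    refine Set.mem_of_eq_of_mem ?_ h5
    rw [h3] at h2
    rw [mul_sub, mul_one, map_sub, map_sub, map_sub, ← ht, h2]
    ring
  have hp0 : (p : ℚ) ≠ 0 := by exact_mod_cast hp.out.ne_zero
  have h7 := mul_mem_pIdeal prime_inv_mem_pIdeal h6
  rw [inv_mul_cancel_left₀ hp0] at h7
  exact h7

end Dwork

section exp

variable {u v : ℚ⟦X⟧}

theorem constantCoeff_exp_subst (hu : constantCoeff u = 0) :
    constantCoeff ((PowerSeries.exp ℚ).subst u) = 1 := by
  have h := HasSubst.of_constantCoeff_zero' hu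
  have h1 : (PowerSeries.exp ℚ).subst u = 1 + (PowerSeries.exp ℚ - 1).subst u := by
    rw [subst_sub h, ← coe_substAlgHom h, map_one]
    ring
  have h2 : constantCoeff ((PowerSeries.exp ℚ - 1).subst u) = 0 :=
    constantCoeff_subst_eq_zero hu _ (by simp)
  rw [h1, map_add, map_one, h2, add_zero]

theorem derivative_exp_subst (hu : constantCoeff u = 0) :
    d⁄dX ℚ ((PowerSeries.exp ℚ).subst u) = (PowerSeries.exp ℚ).subst u * d⁄dX ℚ u := by
  rw [derivative_subst (HasSubst.of_constantCoeff_zero' hu), derivative_exp]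

theorem exp_subst_add (hu : constantCoeff u = 0) (hv : constantCoeff v = 0) :
    (PowerSeries.exp ℚ).subst (u + v) =
      (PowerSeries.exp ℚ).subst u * (PowerSeries.exp ℚ).subst v := by
  have huv : constantCoeff (u + v) = 0 := by rw [map_add, hu, hv, add_zero]
  have h1 := derivative_exp_subst hu
  have h2 := derivative_exp_subst hv
  have h3 := derivative_exp_subst huv
  have c1 := constantCoeff_exp_subst hu
  have c2 := constantCoeff_exp_subst hv
  have c3 := constantCoeff_exp_subst huv
  generalize (PowerSeries.exp ℚ).subst u = A at *
  generalize (PowerSeries.exp ℚ).subst v = B at *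
  generalize (PowerSeries.exp ℚ).subst (u + v) = C at *
  have hAB : constantCoeff (A * B) ≠ 0 := by rw [map_mul, c1, c2]; norm_num
  -- The quotient has derivative zero and constant term 1.
  have key : C * (A * B)⁻¹ = 1 := by
    apply derivative.ext
    · rw [derivative_one, Derivation.leibniz, derivative_inv', h3, Derivation.leibniz, h1, h2,
        map_add]
      simp only [smul_eq_mul]
      have := PowerSeries.mul_inv_cancel (A * B) hAB
      linear_combination (-C * (A * B)⁻¹ * (d⁄dX ℚ u + d⁄dX ℚ v)) * this
    · rw [map_mul, c3, PowerSeries.constantCoeff_inv, map_mul, c1, c2]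
      norm_num
  have h5 := PowerSeries.inv_mul_cancel (A * B) hAB
  calc C = C * ((A * B)⁻¹ * (A * B)) := by rw [h5, mul_one]
    _ = A * B := by rw [← mul_assoc, key, one_mul]

theorem exp_subst_nsmul (hu : constantCoeff u = 0) (n : ℕ) :
    (PowerSeries.exp ℚ).subst (n • u) = ((PowerSeries.exp ℚ).subst u) ^ n := by
  induction n with
  | zero =>
    rw [zero_smul, pow_zero, subst_zero_eq_C_constantCoeff, constantCoeff_exp, map_one]
    exact map_one _
  | succ n ih =>
    rw [succ_nsmul, exp_subst_add (by rw [map_nsmul, hu, smul_zero]) hu, ih, pow_succ]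

variable {p : ℕ} [hp : Fact p.Prime]

theorem exp_subst_sub_one_mem (hu : constantCoeff u = 0) (hup : u ∈ seriesIdeal p 1) :
    (PowerSeries.exp ℚ).subst u - 1 ∈ seriesIdeal p 1 := fun n => by
  have h := HasSubst.of_constantCoeff_zero' hu
  have h1 : (PowerSeries.exp ℚ).subst u - 1 = (PowerSeries.exp ℚ - 1).subst u := by
    rw [subst_sub h]
    congr 1
    rw [← coe_substAlgHom h, map_one]
  have hpow (d : ℕ) : u ^ d ∈ seriesIdeal p d := by
    induction d with
    | zero => simpa using one_mem_seriesIdeal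
    | succ d ih =>
      rw [pow_succ]
      exact_mod_cast mul_mem_seriesIdeal ih hup
  rw [h1, coeff_subst' h]
  refine finsum_induction (fun x => x ∈ pIdeal p 1) (zero_mem _) (fun _ _ => add_mem) fun d => ?_
  rcases Nat.eq_zero_or_pos d with rfl | hd
  · simp [zero_mem]
  · rw [map_sub, coeff_exp, coeff_one, if_neg hd.ne', sub_zero, smul_eq_mul]
    -- v_p(d!) ≤ d - 1 leaves one factor p in u^d / d!, for p = 2 as well.
    have h2 := padicValNat_factorial_lt_of_ne_zero p hd.ne'
    have h3 := natCast_inv_mem_pIdeal (p := p) (n := d.factorial) (k := (d : ℤ) - 1) (by omega)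
    refine mul_mem_pIdeal_of_eq (r := -((d : ℤ) - 1)) ?_ (hpow d n) (by omega)
    simpa using h3

/-- Dwork's lemma for the exponential of a power series. -/
theorem exp_subst_mem_seriesIdeal (hu : constantCoeff u = 0)
    (h : expand p hp.out.ne_zero u - p • u ∈ seriesIdeal p 1) :
    (PowerSeries.exp ℚ).subst u ∈ seriesIdeal p 0 := by
  have hX : HasSubst (X ^ p : ℚ⟦X⟧) := HasSubst.X_pow hp.out.ne_zero
  have hw : constantCoeff (expand p hp.out.ne_zero u - p • u) = 0 := by
    rw [map_sub, constantCoeff_expand, map_nsmul, hu, smul_zero, sub_zero]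
  refine mem_seriesIdeal_of_expand_eq (constantCoeff_exp_subst hu)
    (exp_subst_sub_one_mem hw h) (constantCoeff_exp_subst hw) ?_
  rw [← exp_subst_nsmul hu, ← exp_subst_add (by rw [map_nsmul, hu, smul_zero]) hw,
    add_sub_cancel, expand_apply, expand_apply,
    subst_comp_subst_apply (HasSubst.of_constantCoeff_zero' hu) hX]

end exp

end DworkLemma

/-! ### Integrality of the root, and the Landau condition. -/

section Roots

open Finset PowerSeries

variable {p : ℕ} [hp : Fact p.Prime]

theorem coeff_mul_expand (u v : ℚ⟦X⟧) (N : ℕ) :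
    coeff N (u * expand p hp.out.ne_zero v) =
      ∑ j ∈ range (N / p + 1), coeff (N % p + p * j) u * coeff (N / p - j) v := by
  have hN := Nat.mod_add_div N p
  rw [coeff_mul]
  symm
  refine sum_of_injOn (fun j => (N % p + p * j, p * (N / p - j))) ?_ ?_ ?_ ?_
  · intro i _ j _ hij
    simpa [hp.out.ne_zero] using congrArg Prod.fst hij
  · intro j hj
    have hj' : j ≤ N / p := Nat.lt_succ_iff.1 (mem_range.1 hj)
    simp only [mem_coe, HasAntidiagonal.mem_antidiagonal]
    rw [add_assoc, ← mul_add, Nat.add_sub_cancel' hj', hN]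
  · rintro ⟨x, y⟩ hxy hnot
    rw [HasAntidiagonal.mem_antidiagonal] at hxy
    simp only at hxy ⊢
    rw [coeff_expand, if_neg, mul_zero]
    rintro ⟨c, rfl⟩
    have hc : c ≤ N / p := (Nat.le_div_iff_mul_le hp.out.pos).2 (by rw [mul_comm]; omega)
    refine hnot ⟨N / p - c, by simp, Prod.ext ?_ ?_⟩
    · simp only
      have : p * (N / p - c) + p * c = p * (N / p) := by rw [← mul_add, Nat.sub_add_cancel hc]
      omega
    · simp only
      rw [Nat.sub_sub_self hc]
  · intro j _
    rw [coeff_expand_mul]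

variable {q₁ q₂ : ℕ} {e : Fin q₁ → ℕ} {f : Fin q₂ → ℕ} {M : ℕ}

/-- The series `∑ Q(n) H_{L n} z ^ n`. -/
def serHarmonic (e : Fin q₁ → ℕ) (f : Fin q₂ → ℕ) (L : ℕ) : ℚ⟦X⟧ :=
  PowerSeries.mk fun n => factRatio e f n * harmonic (L * n)

theorem serG_eq (e : Fin q₁ → ℕ) (f : Fin q₂ → ℕ) :
    serG e f = ∑ i, (e i : ℚ) • serHarmonic e f (e i) - ∑ j, (f j : ℚ) • serHarmonic e f (f j) := by
  ext n
  simp only [serG, serHarmonic, coeff_mk, map_sub, map_sum, coeff_smul, smul_eq_mul, mul_sub,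
    mul_sum]
  congr 1 <;> exact sum_congr rfl fun _ _ => by ring

/-- The bilinear expression `F(z) u(z ^ p) - p F(z ^ p) u(z)`, as an additive map in `u`. -/
noncomputable def dworkMap (e : Fin q₁ → ℕ) (f : Fin q₂ → ℕ) (p : ℕ) [hp : Fact p.Prime] :
    ℚ⟦X⟧ →ₗ[ℚ] ℚ⟦X⟧ where
  toFun u := serF e f * expand p hp.out.ne_zero u - p • (u * expand p hp.out.ne_zero (serF e f))
  map_add' u v := by rw [map_add, add_mul, smul_add]; ring
  map_smul' c u := by
    rw [expand_smul, RingHom.id_apply, mul_smul_comm, smul_mul_assoc, smul_sub, smul_comm p c]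

theorem Admissible.dworkMap_serHarmonic_mem (h : Admissible e f M) {L t : ℕ} (hL0 : 0 < L)
    (hL : p ^ t * L ≤ M) : dworkMap e f p (serHarmonic e f L) ∈ seriesIdeal p (t + 1) := fun N => by
  refine Set.mem_of_eq_of_mem ?_
    (h.sum_factRatio_mul_harmonic_mem hL0 hL (Nat.mod_lt N hp.out.pos) (N / p))
  simp only [dworkMap, LinearMap.coe_mk, AddHom.coe_mk, map_sub, map_nsmul]
  simp only [coeff_mul_expand, serHarmonic, serF, coeff_mk, nsmul_eq_mul, mul_sum]
  rw [← sum_sub_distrib]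
  exact sum_congr rfl fun j _ => by ring

theorem Admissible.dworkMap_smul_serHarmonic_mem (h : Admissible e f M) {L : ℕ} (hL0 : 0 < L)
    (hLM : L ∣ M) : dworkMap e f p (((L : ℚ) / M) • serHarmonic e f L) ∈ seriesIdeal p 1 := by
  obtain ⟨d, rfl⟩ := hLM
  have hd0 : 0 < d := Nat.pos_of_mul_pos_left h.pos
  -- With t = v_p(M/L), the gain p^(t+1) pays exactly for dividing by d = M/L.
  have hL : p ^ padicValNat p d * L ≤ L * d := by
    rw [mul_comm]
    exact Nat.mul_le_mul_left _ (Nat.le_of_dvd hd0 pow_padicValNat_dvd)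
  have h1 : ((L : ℚ) / (L * d : ℕ)) = (d : ℚ)⁻¹ := by
    have : (L : ℚ) ≠ 0 := by exact_mod_cast hL0.ne'
    have : (d : ℚ) ≠ 0 := by exact_mod_cast hd0.ne'
    push_cast
    field_simp
  rw [h1, map_smul]
  have h2 := smul_mem_seriesIdeal (natCast_inv_mem_pIdeal (p := p) (n := d) le_rfl)
    (h.dworkMap_serHarmonic_mem hL0 hL)
  exact seriesIdeal_mono (by omega) h2

theorem Admissible.dworkMap_serG_mem (h : Admissible e f M) (he : ∀ i, 0 < e i)
    (hf : ∀ j, 0 < f j) (heM : ∀ i, e i ∣ M) (hfM : ∀ j, f j ∣ M) :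
    dworkMap e f p ((M : ℚ)⁻¹ • serG e f) ∈ seriesIdeal p 1 := by
  have hM : (M : ℚ) ≠ 0 := by exact_mod_cast h.pos.ne'
  simp only [serG_eq, smul_sub, smul_sum, smul_smul, map_sub, map_sum, inv_mul_eq_div]
  exact sub_mem (sum_mem fun i _ => h.dworkMap_smul_serHarmonic_mem (he i) (heM i))
    (sum_mem fun j _ => h.dworkMap_smul_serHarmonic_mem (hf j) (hfM j))

theorem Admissible.exp_subst_serGdivF_mem (h : Admissible e f M) (he : ∀ i, 0 < e i)
    (hf : ∀ j, 0 < f j) (heM : ∀ i, e i ∣ M) (hfM : ∀ j, f j ∣ M) :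
    (PowerSeries.exp ℚ).subst ((M : ℚ)⁻¹ • serGdivF e f) ∈ seriesIdeal p 0 := by
  have hF : serF e f ∈ seriesIdeal p 0 := fun n => by
    rw [serF, coeff_mk]
    exact h.factRatio_mem_zero n
  have hF1 := constantCoeff_serF e f
  have hI := inv_mem_seriesIdeal hF hF1
  have hFI : serF e f * (serF e f)⁻¹ = 1 :=
    PowerSeries.mul_inv_cancel _ (by rw [hF1]; exact one_ne_zero)
  refine exp_subst_mem_seriesIdeal ?_ ?_
  · rw [← coeff_zero_eq_constantCoeff_apply, coeff_smul, coeff_zero_eq_constantCoeff_apply,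
      constantCoeff_serGdivF, smul_zero]
  · have hFI' := congrArg (expand p hp.out.ne_zero) hFI
    rw [map_mul, map_one] at hFI'
    refine Set.mem_of_eq_of_mem ?_ (mul_mem_seriesIdeal_zero (mul_mem_seriesIdeal_zero hI
      (expand_mem_seriesIdeal hI)) (h.dworkMap_serG_mem he hf heM hfM))
    have e1 : (M : ℚ)⁻¹ • serGdivF e f = ((M : ℚ)⁻¹ • serG e f) * (serF e f)⁻¹ := by
      rw [serGdivF, smul_mul_assoc]
    rw [e1, map_mul]
    simp only [dworkMap, LinearMap.coe_mk, AddHom.coe_mk, nsmul_eq_mul]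
    generalize (M : ℚ)⁻¹ • serG e f = G
    generalize (serF e f)⁻¹ = I at *
    generalize serF e f = F at *
    generalize expand p hp.out.ne_zero F = F' at *
    generalize expand p hp.out.ne_zero I = I' at *
    generalize expand p hp.out.ne_zero G = G' at *
    linear_combination (-I' * G') * hFI + (p * I * G) * hFI'

theorem divZ_canonicalCoord (e : Fin q₁ → ℕ) (f : Fin q₂ → ℕ) :
    divZ (canonicalCoord e f) = (PowerSeries.exp ℚ).subst (serGdivF e f) := by
  ext n
  rw [divZ, coeff_mk, canonicalCoord, coeff_succ_X_mul]

/-- Integrality of the `M`-th root of `z⁻¹ q(z)` when all the terms of `e` and `f` divide `M`. -/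
theorem Admissible.hasIntegralRoot (h : Admissible e f M) (he : ∀ i, 0 < e i)
    (hf : ∀ j, 0 < f j) (heM : ∀ i, e i ∣ M) (hfM : ∀ j, f j ∣ M) :
    HasIntegralRoot (divZ (canonicalCoord e f)) M := by
  have hM : (M : ℚ) ≠ 0 := by exact_mod_cast h.pos.ne'
  have h0 : constantCoeff ((M : ℚ)⁻¹ • serGdivF e f) = 0 := by
    rw [← coeff_zero_eq_constantCoeff_apply, coeff_smul, coeff_zero_eq_constantCoeff_apply,
      constantCoeff_serGdivF, smul_zero]
  set r := (PowerSeries.exp ℚ).subst ((M : ℚ)⁻¹ • serGdivF e f) with hr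
  have hint (n : ℕ) : ∃ c : ℤ, (c : ℚ) = coeff n r := exists_int_of_forall_mem_pIdeal
    fun p _ => h.exp_subst_serGdivF_mem (p := p) he hf heM hfM n
  choose c hc using hint
  have hmap : PowerSeries.map (Int.castRingHom ℚ) (PowerSeries.mk c) = r := by
    ext n
    rw [coeff_map, coeff_mk, eq_intCast, hc]
  refine ⟨PowerSeries.mk c, ?_, ?_⟩
  · have h1 := hc 0
    rw [coeff_zero_eq_constantCoeff_apply, constantCoeff_exp_subst h0] at h1
    rw [← coeff_zero_eq_constantCoeff_apply, coeff_mk]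
    exact_mod_cast h1
  · rw [hmap, divZ_canonicalCoord, hr, ← exp_subst_nsmul h0, ← Nat.cast_smul_eq_nsmul ℚ,
      smul_smul, mul_inv_cancel₀ hM, one_smul]

theorem floor_natCast_mul_div (c r q : ℕ) : ⌊(c : ℝ) * ((r : ℝ) / q)⌋ = ((c * r / q : ℕ) : ℤ) := by
  rw [← mul_div_assoc, ← Nat.cast_mul, ← Nat.floor_div_eq_div (K := ℝ),
    Int.natCast_floor_eq_floor (by positivity)]

theorem admissible_maxTerm (hM : 0 < maxTerm e f)
    (hsum : ∑ i, e i = ∑ j, f j)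
    (h : ∀ x : ℝ, 1 / (maxTerm e f : ℝ) ≤ x → x < 1 → 1 ≤ landau e f x) :
    Admissible e f (maxTerm e f) where
  pos := hM
  left_le i := (le_sup (f := e) (mem_univ i)).trans (le_max_left _ _)
  right_le j := (le_sup (f := f) (mem_univ j)).trans (le_max_right _ _)
  sum_eq := hsum
  one_le q r hrq hqr := by
    have hq : (0 : ℝ) < q := by exact_mod_cast (by omega : 0 < q)
    have hM' : (0 : ℝ) < maxTerm e f := by exact_mod_cast hM
    have h1 := h ((r : ℝ) / q)
      (by
        rw [div_le_div_iff₀ hM' hq, one_mul, mul_comm]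
        exact_mod_cast hqr)
      (by
        rw [div_lt_one hq]
        exact_mod_cast hrq)
    simp only [landau, floor_natCast_mul_div] at h1
    have h2 : ((∑ j, f j * r / q + 1 : ℕ) : ℤ) ≤ ((∑ i, e i * r / q : ℕ) : ℤ) := by
      push_cast
      push_cast at h1
      linarith
    exact_mod_cast h2

/-- Both sequences are then empty, G = 0, and the series is 1 = 1^0. -/
theorem hasIntegralRoot_zero (he : ∀ i, 0 < e i) (hf : ∀ j, 0 < f j) (hM : maxTerm e f = 0) :
    HasIntegralRoot (divZ (canonicalCoord e f)) 0 := by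
  have h1 : IsEmpty (Fin q₁) := ⟨fun i => by
    have := (le_sup (f := e) (mem_univ i)).trans ((le_max_left _ _).trans hM.le)
    have := he i
    omega⟩
  have h2 : IsEmpty (Fin q₂) := ⟨fun i => by
    have := (le_sup (f := f) (mem_univ i)).trans ((le_max_right _ _).trans hM.le)
    have := hf i
    omega⟩
  have hG : serGdivF e f = 0 := by simp [serGdivF, serG_eq]
  refine ⟨1, map_one _, ?_⟩
  rw [divZ_canonicalCoord, hG, ← zero_smul ℕ (0 : ℚ⟦X⟧), exp_subst_nsmul (map_zero _), pow_zero,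
    pow_zero]

theorem admissible_lcm {n : ℕ} {k : Fin n → ℕ} (hk : ∀ i, 0 < k i)
    (hsum : ∑ i, (1 : ℚ) / (k i : ℚ) = 1) :
    Admissible (fun _ : Fin 1 => univ.lcm k) (fun i : Fin n => univ.lcm k / k i)
      (univ.lcm k) where
  pos := Nat.pos_of_ne_zero fun h0 => by
    obtain ⟨i, _, hi⟩ := lcm_eq_zero_iff.1 h0
    exact (hk i).ne' hi
  left_le _ := le_rfl
  right_le j := Nat.div_le_self _ _
  sum_eq := by
    have h1 (i : Fin n) : ((univ.lcm k / k i : ℕ) : ℚ) = (univ.lcm k : ℕ) * (1 / (k i : ℚ)) := by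
      rw [Nat.cast_div (dvd_lcm (mem_univ i)) (by exact_mod_cast (hk i).ne')]
      ring
    have h2 : ((∑ i, univ.lcm k / k i : ℕ) : ℚ) = (univ.lcm k : ℕ) := by
      rw [Nat.cast_sum]
      simp only [h1]
      rw [← mul_sum, hsum, mul_one]
    rw [Fin.sum_univ_one]
    exact_mod_cast h2.symm
  one_le q r hrq hqr := by
    set K := univ.lcm k with hK
    have hq : 0 < q := by omega
    rw [Fin.sum_univ_one]
    set m := K * r / q with hm
    have hm0 : 0 < m := Nat.div_pos hqr hq
    have hmK : m < K := by
      rw [hm, Nat.div_lt_iff_lt_mul hq]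
      exact Nat.mul_lt_mul_of_pos_left hrq (Nat.pos_of_ne_zero fun h0 => by simp [h0] at hqr; omega)
    have hle (j : Fin n) : K / k j * r / q * k j ≤ m := by
      rw [hm, Nat.le_div_iff_mul_le hq]
      calc K / k j * r / q * k j * q = K / k j * r / q * q * k j := by ring
        _ ≤ K / k j * r * k j := Nat.mul_le_mul_right _ (Nat.div_mul_le_self _ _)
        _ = K / k j * k j * r := by ring
        _ = K * r := by rw [Nat.div_mul_cancel (dvd_lcm (mem_univ j))]
    -- As 0 < m < K, not every k_j divides m, so one of the bounds ⌊w_j r/q⌋ ≤ m/k_j is strict.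
    -- Summing with ∑ 1/k_j = 1 gives the Landau inequality.
    have hnd : ∃ j, ¬ k j ∣ m := by
      by_contra! hdvd
      have : K ≤ m := Nat.le_of_dvd hm0 (lcm_dvd fun j _ => hdvd j)
      omega
    obtain ⟨j₀, hj₀⟩ := hnd
    have hk' (j : Fin n) : (0 : ℚ) < k j := by exact_mod_cast hk j
    have hlt : ∑ j, ((K / k j * r / q : ℕ) : ℚ) < ∑ j, (m : ℚ) * (1 / (k j : ℚ)) := by
      refine sum_lt_sum (fun j _ => ?_) ⟨j₀, mem_univ _, ?_⟩
      · rw [mul_one_div, le_div_iff₀ (hk' j)]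
        exact_mod_cast hle j
      · rw [mul_one_div, lt_div_iff₀ (hk' j₀)]
        have : K / k j₀ * r / q * k j₀ < m :=
          lt_of_le_of_ne (hle j₀) fun h => hj₀ (h ▸ dvd_mul_left _ _)
        exact_mod_cast this
    rw [← mul_sum, hsum, mul_one] at hlt
    exact_mod_cast hlt

end Roots

end MirrorMap

theorem mainTheorem3 :
    (∀ (q₁ q₂ : ℕ) (e : Fin q₁ → ℕ) (f : Fin q₂ → ℕ),
      (∀ i, 0 < e i) → (∀ j, 0 < f j) →
      (∀ i j, e i ≠ f j) →
      ∑ i, e i = ∑ j, f j →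
      (∀ x : ℝ, 1 / (MirrorMap.maxTerm e f : ℝ) ≤ x → x < 1 → 1 ≤ MirrorMap.landau e f x) →
      (∀ i, e i ∣ MirrorMap.maxTerm e f) → (∀ j, f j ∣ MirrorMap.maxTerm e f) →
      MirrorMap.HasIntegralRoot (MirrorMap.divZ (MirrorMap.canonicalCoord e f))
        (MirrorMap.maxTerm e f)) ∧
    (∀ (n : ℕ) (k : Fin n → ℕ),
      (∀ i, 0 < k i) →
      ∑ i, (1 : ℚ) / (k i : ℚ) = 1 →
      MirrorMap.HasIntegralRoot
        (MirrorMap.divZ (MirrorMap.canonicalCoord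
          (fun _ : Fin 1 => Finset.univ.lcm k)
          (fun i : Fin n => Finset.univ.lcm k / k i)))
        (Finset.univ.lcm k)) := by
  refine ⟨fun q₁ q₂ e f he hf _ hsum h heM hfM => ?_, fun n k hk hsum => ?_⟩
  · rcases Nat.eq_zero_or_pos (MirrorMap.maxTerm e f) with hM | hM
    · rw [hM]
      exact MirrorMap.hasIntegralRoot_zero he hf hM
    · exact (MirrorMap.admissible_maxTerm hM hsum h).hasIntegralRoot he hf heM hfM
  -- Not an instance of the first part: n = 1, k = (1) gives e = f = (1), which share a term.
  · have h := MirrorMap.admissible_lcm hk hsum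
    exact h.hasIntegralRoot (fun _ => h.pos)
      (fun i => Nat.div_pos (Nat.le_of_dvd h.pos (Finset.dvd_lcm (Finset.mem_univ i))) (hk i))
      (fun _ => dvd_rfl) (fun i => Nat.div_dvd_of_dvd (Finset.dvd_lcm (Finset.mem_univ i)))
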